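/- **Conventions.** Let $G$ be a countable group. For nonempty finite $F,K\subseteq G$ let $B(F,K)=\{g\in G: Kg\cap F\neq\emptyset,\ Kg\cap(G\setminus F)\neq\emptyset\}$. A Følner sequence is a sequence $(F_n)$ of nonempty finite subsets of $G$ with $|B(F_n,K)|/|F_n|\to0$ for every nonempty finite $K\subseteq G$; $G$ is amenable if it has one. The upper density of $J\subseteq G$ is $\delta(J)=\sup_{(F_n)}\limsup_{n\to\infty}|J\cap F_n|/|F_n|$, the supremum being over all Følner sequences. A polyhedron is a space homeomorphic to the underlying space of a finite simplicial complex, and $\dim$ is the topological (Lebesgue covering) dimension. The group $G$ acts on $P^G$ by $(g'x)_g=x_{gg'}$; a subshift of $P^G$ is a closed $G$-invariant subset with this action. For $A\subseteq G$, $\pi_A:P^G\to P^A$ is the projection. For a compact metric space $(X,d)$ and $\epsilon>0$, $\dim_\epsilon(X,d)$ is the infimum of $\dim Q$ over all compact metric spaces $Q$ admitting a continuous map $f:X\to Q$ such that $f(x)=f(y)$ implies $d(x,y)\le\epsilon$. If $G$ acts on $X$ by homeomorphisms, put $d_F(x,y)=\max_{g\in F}d(gx,gy)$ and $$\mathrm{mdim}_\epsilon(X,d,G)=\lim_{n\to\infty}\frac{\dim_\epsilon(X,d_{F_n})}{|F_n|},\qquad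 \mathrm{mdim}(X,G)=\lim_{\epsilon\to0}\mathrm{mdim}_\epsilon(X,d,G),$$ where $(F_n)$ is a Følner sequence; the first limit exists and is independent of the Følner sequence, and the second is independent of the metric $d$ inducing the topology of $X$. **Corollary 2.11.** Let $G$ be a countable amenable group, let $P$ be a polyhedron with a metric $d$ inducing its topology, and let $X$ be a subshift of $P^G$. Suppose that there are an increasing sequence $J_1\subseteq J_2\subseteq\cdots$ of subsets of $G$, a sequence of numbers $c_n>0$, and a point $x_0\in X$ such that: 1. $\lim_{n\to\infty}\delta(J_n)=1$; 2. for each $n$ there are subsets $W^n_g\subseteq P$ $(g\in G)$ with $\prod_{g\in G}W^n_g\subseteq X$ and $\pi_{G\setminus J_n}(x_0)\in\pi_{G\setminus J_n}\big(\prod_{g\in G}W^n_g\big)$; 3. for each $n$ and each $g\in J_n$ there is a continuous map $f^n_g:P\to W^n_g$ with $d(x,y)\le c_n\,d(f^n_g(x),f^n_g(y))$ for all $x,y\in P$. Then $$\mathrm{mdim}(X,G)=\mathrm{mdim}(P^G,G)=\dim(P).$$ -/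

import Mathlib

open Filter Topology
open scoped ENNReal

noncomputable section

namespace MeanDimension

/-! ### Polyhedra and topological dimension -/

/-- A (compact) polyhedron: a space homeomorphic to the underlying space of a finite geometric
simplicial complex. -/
def IsPolyhedron (P : Type*) [TopologicalSpace P] : Prop :=
  ∃ (N : ℕ) (K : Geometry.SimplicialComplex ℝ (EuclideanSpace ℝ (Fin N))),
    K.faces.Finite ∧ Nonempty (P ≃ₜ K.space)

/-- `α` is a finite open cover of `X`. -/
structure IsFiniteOpenCover {X : Type*} [TopologicalSpace X] (α : Set (Set X)) : Prop where
  finite : α.Finite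
  isOpen : ∀ U ∈ α, IsOpen U
  covers : ⋃₀ α = Set.univ

/-- `β` is finer than `α`: every member of `β` is contained in some member of `α`. -/
def IsFiner {X : Type*} (α β : Set (Set X)) : Prop :=
  ∀ V ∈ β, ∃ U ∈ α, V ⊆ U

/-- The order of a cover: the maximal number of members with a common point, minus one.
(If `X` is nonempty, a cover has at least one member through each point, so that the subtraction
is not truncated.) -/
def coverOrder {X : Type*} (α : Set (Set X)) : ℕ∞ :=
  (⨆ x : X, {U ∈ α | x ∈ U}.encard) - 1

/-- `D(α)`: the least order of a finite open cover that is finer than `α`. -/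
def refinementOrder {X : Type*} [TopologicalSpace X] (α : Set (Set X)) : ℕ∞ :=
  ⨅ (β : Set (Set X)) (_ : IsFiniteOpenCover β) (_ : IsFiner α β), coverOrder β

/-- The topological (Lebesgue covering) dimension of a nonempty space, with values in
`{0, 1, 2, …, ∞}`. -/
def topDim (X : Type*) [TopologicalSpace X] : ℕ∞ :=
  ⨆ (α : Set (Set X)) (_ : IsFiniteOpenCover α), refinementOrder α

/-- A map `f` is `ε`-injective for the distance function `d` if any two points with the same image
are at distance at most `ε`. -/
def IsEpsInjective {X Q : Type*} (d : X → X → ℝ) (ε : ℝ) (f : X → Q) : Prop :=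
  ∀ x y, f x = f y → d x y ≤ ε

/-- `dim_ε(X, d)`: the infimum of the dimensions of the compact metric spaces `Q` that admit an
`ε`-injective continuous map `X → Q`. The distance `d` is meant to induce the topology of `X`.
(Letting `Q` range over `Type` is no restriction, since every compact metric space is
homeomorphic to a subset of the Hilbert cube.) -/
def epsDim (X : Type*) [TopologicalSpace X] (d : X → X → ℝ) (ε : ℝ) : ℕ∞ :=
  ⨅ (Q : Type) (_ : MetricSpace Q) (_ : CompactSpace Q)
    (_ : ∃ f : C(X, Q), IsEpsInjective d ε f), topDim Q

/-! ### Amenable groups -/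

/-- The `K`-boundary `B(F, K)` of `F`: all `g` such that the translate `K g` meets both `F` and
the complement of `F`. -/
def boundary {G : Type*} [Group G] (F K : Finset G) : Set G :=
  {g | (∃ k ∈ K, k * g ∈ F) ∧ (∃ k ∈ K, k * g ∉ F)}

/-- `F` is a Følner sequence of nonempty finite subsets of `G`. -/
structure IsFolnerSeq {G : Type*} [Group G] (F : ℕ → Finset G) : Prop where
  nonempty : ∀ n, (F n).Nonempty
  tendsto : ∀ K : Finset G, K.Nonempty →
    Tendsto (fun n => ((boundary (F n) K).ncard : ℝ) / ((F n).card : ℝ)) atTop (𝓝 0)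

/-- A (discrete) group is amenable if it admits a Følner sequence. -/
def IsAmenable (G : Type*) [Group G] : Prop :=
  ∃ F : ℕ → Finset G, IsFolnerSeq F

/-- The upper density `δ(J)`: the supremum, over all Følner sequences `F` of `G`, of
`limsup |J ∩ F n| / |F n|`. -/
def upperDensity {G : Type*} [Group G] (J : Set G) : ℝ≥0∞ :=
  ⨆ (F : ℕ → Finset G) (_ : IsFolnerSeq F),
    limsup (fun n => ((J ∩ (F n : Set G)).ncard : ℝ≥0∞) / ((F n).card : ℝ≥0∞)) atTop

/-! ### Mean topological dimension -/

/-- The distance `d_F(x, y) = max_{g ∈ F} d(g x, g y)` on a `G`-space, for a nonempty finite set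
`F ⊆ G`. -/
def dynDist {G X : Type*} [Group G] [MulAction G X] (d : X → X → ℝ) (F : Finset G) :
    X → X → ℝ :=
  fun x y => ⨆ g : F, d ((g : G) • x) ((g : G) • y)

/-- `HasMeanDim G X m` states that the mean topological dimension of the `G`-space `X` exists and
equals `m`. That is: for every metric `d` inducing the topology of `X` and every `ε > 0`, the limit
`mdim_ε(X, d, G) = lim_n dim_ε(X, d_{F n}) / |F n|` exists along every Følner sequence `F` and does
not depend on `F`; and `mdim_ε(X, d, G)` tends to `m` as `ε → 0`. -/
def HasMeanDim (G X : Type*) [Group G] [t : TopologicalSpace X] [MulAction G X] (m : ℝ≥0∞) :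
    Prop :=
  ∀ d : MetricSpace X, d.toUniformSpace.toTopologicalSpace = t →
    ∃ mdimEps : ℝ → ℝ≥0∞,
      (∀ ε : ℝ, 0 < ε → ∀ F : ℕ → Finset G, IsFolnerSeq F →
        Tendsto (fun n => (epsDim X (dynDist d.dist (F n)) ε : ℝ≥0∞) / ((F n).card : ℝ≥0∞))
          atTop (𝓝 (mdimEps ε))) ∧
      Tendsto mdimEps (𝓝[>] 0) (𝓝 m)

/-! ### Subshifts -/

/-- The shift on `P^G`: `(g' x)_g = x_{g g'}`. -/
def shift {G P : Type*} [Group G] (g' : G) (x : G → P) : G → P :=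
  fun g => x (g * g')

/-- A subshift of `P^G`: a closed subset which is invariant under the shift. -/
structure Subshift (G P : Type*) [Group G] [TopologicalSpace P] where
  carrier : Set (G → P)
  isClosed : IsClosed carrier
  shift_mem : ∀ (g : G), ∀ x ∈ carrier, shift g x ∈ carrier

/-- The shift action of `G` on a subshift. -/
instance {G P : Type*} [Group G] [TopologicalSpace P] (X : Subshift G P) :
    MulAction G X.carrier where
  smul g x := ⟨shift g x.1, X.shift_mem g x.1 x.2⟩
  one_smul x := Subtype.ext (funext fun h => congrArg x.1 (mul_one h))
  mul_smul g g' x := Subtype.ext (funext fun h => congrArg x.1 (mul_assoc h g g').symm)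

/-- The full shift `P^G`. -/
def fullShift (G P : Type*) [Group G] [TopologicalSpace P] : Subshift G P where
  carrier := Set.univ
  isClosed := isClosed_univ
  shift_mem := fun _ _ _ => trivial

end MeanDimension

end

open MeanDimension

/-! ### Covering dimension -/

/-! Write m for the dimension of P, which is the largest dimension of a simplex in a triangulation.
The proof squeezes the widths of X between multiples of m.

Upper bound: by compactness, d(x, y) < ε as soon as x and y agree on a finite set K of coordinates.
Restriction to the coordinates in KF is then ε-injective for d_F, with values in a space of
dimension at most m|KF|, and |KF|/|F| tends to 1 along a Følner sequence (`epsDim_subshift_le`,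
`card_mul_le_add_boundary`).

Lower bound: P contains an m-cube. Placing copies of it at the coordinates in J ∩ F through the maps
f_g, and a fixed point of the product elsewhere, embeds a cube of dimension m|J ∩ F| into X. Since c
does not depend on g, there is one ε₀, independent of F, for which no ε-injective map with ε ≤ ε₀
identifies points of opposite faces. Lebesgue's covering theorem (`card_le_topDim`) then bounds the
width below. Dividing by |F| gives at least m times the density of J along the chosen Følner
sequence. As the limit is the same along all Følner sequences, that sequence may be chosen to nearly
attain δ(J), and δ(J_n) → 1 finishes the proof.

Existence and independence of the limit come from the Ornstein–Weiss lemma. The subadditivity it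
needs is the product inequality for covering dimension, obtained from Ostrand's colourings.
Lebesgue's theorem is derived from a parity count on Kuhn's triangulation. -/

theorem topDim_le_of_refinement {X : Type*} [TopologicalSpace X] {m : ℕ}
    (h : ∀ α : Set (Set X), IsFiniteOpenCover α → ∃ (κ : Type) (_ : Finite κ) (V : κ → Set X),
      (∀ k, IsOpen (V k)) ∧ (∀ x, ∃ k, x ∈ V k) ∧ (∀ k, ∃ U ∈ α, V k ⊆ U) ∧
      ∀ x, {k | x ∈ V k}.encard ≤ m + 1) : topDim X ≤ m := by
  refine iSup₂_le fun α hα => ?_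
  obtain ⟨κ, _, V, hVo, hVc, hVα, hVm⟩ := h α hα
  have hβ : IsFiniteOpenCover (Set.range V) :=
    ⟨Set.finite_range V, by rintro _ ⟨k, rfl⟩; exact hVo k, by
      rw [Set.sUnion_range]; exact Set.eq_univ_of_forall fun x => Set.mem_iUnion.2 (hVc x)⟩
  have hfin : IsFiner α (Set.range V) := by rintro _ ⟨k, rfl⟩; exact hVα k
  refine (iInf₂_le_of_le _ hβ (iInf_le _ hfin)).trans ?_
  refine tsub_le_iff_right.2 (iSup_le fun x => ?_)
  refine le_trans ?_ (hVm x)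
  have : {U ∈ Set.range V | x ∈ U} ⊆ V '' {k | x ∈ V k} := by
    rintro _ ⟨⟨k, rfl⟩, hk⟩
    exact ⟨k, hk, rfl⟩
  exact (Set.encard_le_encard this).trans (Set.encard_image_le _ _)

/-- Each member of a refinement of small order is assigned to one `U i` containing it, and the
members with the same index are united. Distinct indices at a point come from distinct members, so
multiplicity does not grow. -/
theorem exists_shrinking_of_topDim_le {X : Type*} [TopologicalSpace X] {m : ℕ}
    (h : topDim X ≤ m) {ι : Type*} [Finite ι] (U : ι → Set X) (hUo : ∀ i, IsOpen (U i))
    (hUc : ∀ x, ∃ i, x ∈ U i) :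
    ∃ V : ι → Set X, (∀ i, IsOpen (V i)) ∧ (∀ x, ∃ i, x ∈ V i) ∧ (∀ i, V i ⊆ U i) ∧
      ∀ x, {i | x ∈ V i}.encard ≤ m + 1 := by
  have hα : IsFiniteOpenCover (Set.range U) :=
    ⟨Set.finite_range U, by rintro _ ⟨k, rfl⟩; exact hUo k, by
      rw [Set.sUnion_range]; exact Set.eq_univ_of_forall fun x => Set.mem_iUnion.2 (hUc x)⟩
  have h1 : refinementOrder (Set.range U) < m + 1 :=
    lt_of_le_of_lt ((le_iSup₂ (f := fun α (_ : IsFiniteOpenCover α) => refinementOrder α)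
      _ hα).trans h) (by exact_mod_cast Nat.lt_succ_self m)
  simp only [refinementOrder, iInf_lt_iff] at h1
  obtain ⟨β, hβ, hfin, hlt⟩ := h1
  have hord : ∀ x, {W ∈ β | x ∈ W}.encard ≤ m + 1 := fun x => by
    have : coverOrder β ≤ m := Order.lt_add_one_iff_of_not_isMax (by simp) |>.1 hlt
    exact (le_iSup (fun x => {W ∈ β | x ∈ W}.encard) x).trans (tsub_le_iff_right.1 this)
  have hch : ∀ W : β, ∃ i, (W : Set X) ⊆ U i := fun W => by
    obtain ⟨_, ⟨i, rfl⟩, hi⟩ := hfin W W.2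
    exact ⟨i, hi⟩
  choose φ hφ using hch
  refine ⟨fun i => ⋃ W : β, ⋃ _ : φ W = i, (W : Set X), fun i => isOpen_iUnion fun W =>
    isOpen_iUnion fun _ => hβ.isOpen W W.2, fun x => ?_, fun i => ?_, fun x => ?_⟩
  · have : x ∈ ⋃₀ β := hβ.covers ▸ Set.mem_univ x
    obtain ⟨W, hW, hx⟩ := this
    exact ⟨φ ⟨W, hW⟩, Set.mem_iUnion.2 ⟨⟨W, hW⟩, Set.mem_iUnion.2 ⟨rfl, hx⟩⟩⟩
  · refine Set.iUnion_subset fun W => Set.iUnion_subset fun hW => ?_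
    rw [← hW]; exact hφ W
  · refine le_trans ?_ (hord x)
    have : {i | x ∈ ⋃ W : β, ⋃ _ : φ W = i, (W : Set X)} ⊆
        φ '' {W : β | x ∈ (W : Set X)} := by
      rintro i hi
      simp only [Set.mem_ofPred_eq, Set.mem_iUnion] at hi
      obtain ⟨W, hW, hx⟩ := hi
      exact ⟨W, hx, hW⟩
    refine (Set.encard_le_encard this).trans ((Set.encard_image_le _ _).trans ?_)
    rw [← Subtype.val_injective.encard_image]
    refine Set.encard_le_encard ?_
    rintro _ ⟨W, hW, rfl⟩
    exact ⟨W.2, hW⟩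

theorem topDim_le_of_shrinking {X : Type*} [TopologicalSpace X] {m : ℕ}
    (h : ∀ (N : ℕ) (U : Fin N → Set X), (∀ i, IsOpen (U i)) → (∀ x, ∃ i, x ∈ U i) →
      ∃ V : Fin N → Set X, (∀ i, IsOpen (V i)) ∧ (∀ x, ∃ i, x ∈ V i) ∧ (∀ i, V i ⊆ U i) ∧
      ∀ x, {i | x ∈ V i}.encard ≤ m + 1) : topDim X ≤ m := by
  refine topDim_le_of_refinement fun α hα => ?_
  obtain ⟨N, ⟨e⟩⟩ := hα.finite.to_subtype.exists_equiv_fin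
  obtain ⟨V, h1, h2, h3, h4⟩ := h N (fun i => (e.symm i : Set X)) (fun i => hα.isOpen _ (e.symm i).2)
    (fun x => by
      have : x ∈ ⋃₀ α := hα.covers ▸ Set.mem_univ x
      obtain ⟨W, hW, hx⟩ := this
      exact ⟨e ⟨W, hW⟩, by simpa using hx⟩)
  exact ⟨Fin N, inferInstance, V, h1, h2, fun k => ⟨_, (e.symm k).2, h3 k⟩, h4⟩

theorem topDim_le_of_isClosedEmbedding {X Y : Type*} [TopologicalSpace X] [TopologicalSpace Y]
    {f : X → Y} (hf : IsClosedEmbedding f) {m : ℕ} (h : topDim Y ≤ m) : topDim X ≤ m := by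
  refine topDim_le_of_shrinking fun N U hUo hUc => ?_
  choose O hO hOU using fun i => hf.isInducing.isOpen_iff.1 (hUo i)
  -- The extra index `none` carries the complement of the image, so that the extended sets cover
  -- `Y`; it disappears on pulling back.
  obtain ⟨V, hVo, hVc, hVU, hVm⟩ := exists_shrinking_of_topDim_le h
    (fun i : Option (Fin N) => i.elim (Set.range f)ᶜ O)
    (fun i => by cases i; exacts [hf.isClosed_range.isOpen_compl, hO _])
    (fun y => by
      by_cases hy : y ∈ Set.range f
      · obtain ⟨x, rfl⟩ := hy
        obtain ⟨i, hi⟩ := hUc x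
        exact ⟨some i, by rw [← hOU] at hi; exact hi⟩
      · exact ⟨none, hy⟩)
  refine ⟨fun i => f ⁻¹' V (some i), fun i => (hVo _).preimage hf.continuous, fun x => ?_,
    fun i => ?_, fun x => ?_⟩
  · obtain ⟨_ | i, hi⟩ := hVc (f x)
    · exact absurd ⟨x, rfl⟩ (hVU none hi)
    · exact ⟨i, hi⟩
  · rw [← hOU]; exact Set.preimage_mono (hVU (some i))
  · refine le_trans ?_ (hVm (f x))
    rw [← (Option.some_injective (Fin N)).encard_image]
    refine Set.encard_le_encard ?_
    rintro _ ⟨i, hi, rfl⟩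
    exact hi

theorem Homeomorph.topDim_le {X Y : Type*} [TopologicalSpace X] [TopologicalSpace Y]
    (e : X ≃ₜ Y) {m : ℕ} (h : topDim Y ≤ m) : topDim X ≤ m :=
  topDim_le_of_isClosedEmbedding e.isClosedEmbedding h

/-- The sum theorem for finite closed covers. -/
theorem topDim_le_of_closed_cover {X : Type*} [TopologicalSpace X] {m : ℕ} (S : Finset (Set X))
    (hcl : ∀ A ∈ S, IsClosed A) (hcov : ∀ x, ∃ A ∈ S, x ∈ A)
    (hdim : ∀ A ∈ S, topDim A ≤ m) : topDim X ≤ m := by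
  classical
  refine topDim_le_of_shrinking fun N U hUo hUc => ?_
  suffices H : ∀ T ⊆ S, ∃ V : Fin N → Set X, (∀ i, IsOpen (V i)) ∧ (∀ x, ∃ i, x ∈ V i) ∧
      (∀ i, V i ⊆ U i) ∧ ∀ A ∈ T, ∀ x ∈ A, {i | x ∈ V i}.encard ≤ m + 1 by
    obtain ⟨V, h1, h2, h3, h4⟩ := H S subset_rfl
    refine ⟨V, h1, h2, h3, fun x => ?_⟩
    obtain ⟨A, hA, hx⟩ := hcov x
    exact h4 A hA x hx
  intro T
  induction T using Finset.induction_on with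
  | empty => exact fun _ => ⟨U, hUo, hUc, fun _ => subset_rfl, by simp⟩
  | insert A T _ ih =>
    intro hT
    obtain ⟨V, hVo, hVc, hVU, hVm⟩ := ih ((Finset.subset_insert _ _).trans hT)
    have hA := hT (Finset.mem_insert_self A T)
    obtain ⟨W, hWo, hWc, hWV, hWm⟩ := exists_shrinking_of_topDim_le (hdim A hA)
      (fun i => ((↑) : A → X) ⁻¹' V i) (fun i => (hVo i).preimage continuous_subtype_val)
      (fun x => hVc x)
    choose O hO hOW using fun i => isOpen_induced_iff.1 (hWo i)
    have hmem : ∀ i (x : A), (x : X) ∈ O i ↔ x ∈ W i := fun i x => by rw [← hOW]; rfl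
    -- The cover is refined on `A` and left alone off `A`. Sets only shrink, so the bounds on the
    -- closed sets already treated survive.
    refine ⟨fun i => V i ∩ (O i ∪ Aᶜ), fun i => (hVo i).inter ((hO i).union
      (hcl A hA).isOpen_compl), fun x => ?_, fun i => Set.inter_subset_left.trans (hVU i), ?_⟩
    · by_cases hx : x ∈ A
      · obtain ⟨i, hi⟩ := hWc ⟨x, hx⟩
        exact ⟨i, hWV i hi, Or.inl ((hmem i ⟨x, hx⟩).2 hi)⟩
      · obtain ⟨i, hi⟩ := hVc x
        exact ⟨i, hi, Or.inr hx⟩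
    · intro B hB x hx
      rcases Finset.mem_insert.1 hB with rfl | hB
      · refine le_trans (Set.encard_le_encard fun i hi => ?_) (hWm ⟨x, hx⟩)
        rcases hi.2 with h | h
        · exact (hmem i ⟨x, hx⟩).1 h
        · exact absurd hx h
      · exact le_trans (Set.encard_le_encard fun i hi => hi.1) (hVm B hB x hx)

/-! ### Ostrand's colourings -/

/-- The cover `U` has open refinements `V c`, one for each colour `c`, each consisting of pairwise
disjoint sets, such that every point is missed by at most `m` of them. -/
def HasDisjointRefinements {X ι : Type*} [TopologicalSpace X] (U : ι → Set X) (m : ℕ)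
    (C : Type*) : Prop :=
  ∃ V : C → ι → Set X, (∀ c i, IsOpen (V c i)) ∧ (∀ c i, V c i ⊆ U i) ∧
    (∀ c i j x, x ∈ V c i → x ∈ V c j → i = j) ∧ ∀ x, {c | ∀ i, x ∉ V c i}.encard ≤ m

theorem HasDisjointRefinements.congr {X ι C D : Type*} [TopologicalSpace X] {U : ι → Set X} {m : ℕ}
    (h : HasDisjointRefinements U m C) (e : D ≃ C) : HasDisjointRefinements U m D := by
  obtain ⟨V, h1, h2, h3, h4⟩ := h
  refine ⟨fun d => V (e d), fun _ => h1 _, fun _ => h2 _, fun _ => h3 _, fun x => ?_⟩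
  rw [← e.injective.encard_image]
  refine le_trans (Set.encard_le_encard ?_) (h4 x)
  rintro _ ⟨d, hd, rfl⟩
  exact hd

/-- Colour by cardinality: for a subordinate partition of unity let `W S` be the set where the
functions indexed by `S` are positive and exceed all others. Two different `S` of equal size give
disjoint sets, and the maximising indices at a point form an `S` with at most m + 1 elements. -/
theorem hasDisjointRefinements_of_topDim_le {X ι : Type*} [TopologicalSpace X] [NormalSpace X]
    [Finite ι] {m : ℕ} (h : topDim X ≤ m) (U : ι → Set X) (hUo : ∀ i, IsOpen (U i))
    (hUc : ∀ x, ∃ i, x ∈ U i) : HasDisjointRefinements U m (Fin (m + 1)) := by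
  classical
  have := Fintype.ofFinite ι
  obtain ⟨V, hVo, hVc, hVU, hVm⟩ := exists_shrinking_of_topDim_le h U hUo hUc
  obtain ⟨f, hf⟩ := PartitionOfUnity.exists_isSubordinate_of_locallyFinite (isClosed_univ (X := X))
    V hVo (locallyFinite_of_finite V) (fun x _ => Set.mem_iUnion.2 (hVc x))
  let W : Finset ι → Set X := fun S => {x | ∀ i ∈ S, 0 < f i x ∧ ∀ j ∉ S, f j x < f i x}
  have hWo : ∀ S, IsOpen (W S) := fun S => by
    have : W S = ⋂ i ∈ S, ({x | 0 < f i x} ∩ ⋂ j ∈ Sᶜ, {x | f j x < f i x}) := by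
      ext x; simp [W]
    rw [this]
    refine isOpen_biInter_finset fun i _ => (isOpen_lt continuous_const (f i).continuous).inter
      (isOpen_biInter_finset fun j _ => isOpen_lt (f j).continuous (f i).continuous)
  have hWV : ∀ S, ∀ i ∈ S, W S ⊆ V i := fun S i hi x hx =>
    hf i (subset_tsupport _ (hx i hi).1.ne')
  have hWd : ∀ S T : Finset ι, S.card = T.card → ∀ x, x ∈ W S → x ∈ W T → S = T := by
    intro S T hST x hS hT
    by_contra hne
    obtain ⟨i, hiS, hiT⟩ : ∃ i ∈ S, i ∉ T := by
      by_contra! hc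
      exact hne (Finset.eq_of_subset_of_card_le hc hST.ge)
    obtain ⟨j, hjT, hjS⟩ : ∃ i ∈ T, i ∉ S := by
      by_contra! hc
      exact hne (Finset.eq_of_subset_of_card_le hc hST.le).symm
    exact lt_asymm ((hS i hiS).2 j hjS) ((hT j hjT).2 i hiT)
  -- Colour `c` collects the `S` of size `c + 1`; each `W S` is credited to one chosen element of
  -- `S`.
  refine ⟨fun c i => ⋃ S : Finset ι, ⋃ _ : S.card = c + 1 ∧ ∃ hS : S.Nonempty, hS.choose = i, W S,
    fun c i => isOpen_iUnion fun S => isOpen_iUnion fun _ => hWo S, fun c i => ?_, ?_, fun x => ?_⟩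
  · refine Set.iUnion_subset fun S => Set.iUnion_subset fun ⟨_, hS, hi⟩ => ?_
    exact (hWV S i (hi ▸ hS.choose_spec)).trans (hVU i)
  · intro c i j x hi hj
    simp only [Set.mem_iUnion] at hi hj
    obtain ⟨S, ⟨hS, hS', rfl⟩, hxS⟩ := hi
    obtain ⟨T, ⟨hT, hT', rfl⟩, hxT⟩ := hj
    obtain rfl := hWd S T (hS.trans hT.symm) x hxS hxT
    rfl
  · obtain ⟨i₀, hi₀⟩ := f.exists_pos (Set.mem_univ x)
    obtain ⟨i₁, -, hi₁⟩ := Finset.exists_max_image Finset.univ (fun i => f i x) ⟨i₀, by simp⟩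
    let S := Finset.univ.filter fun i => f i x = f i₁ x
    have hpos : 0 < f i₁ x := hi₀.trans_le (hi₁ i₀ (by simp))
    have hxS : x ∈ W S := fun i hi => by
      have hi' : f i x = f i₁ x := by simpa [S] using hi
      refine ⟨hi' ▸ hpos, fun j hj => ?_⟩
      have hj' : f j x ≠ f i₁ x := by simpa [S] using hj
      exact hi' ▸ lt_of_le_of_ne (hi₁ j (by simp)) hj'
    have hSne : S.Nonempty := ⟨i₁, by simp [S]⟩
    have hSc : S.card ≤ m + 1 := by
      have : (S : Set ι).encard ≤ m + 1 :=
        (Set.encard_le_encard fun i hi => hWV S i hi hxS).trans (hVm x)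
      rw [Set.encard_coe_eq_coe_finsetCard] at this
      exact_mod_cast this
    have hSp := hSne.card_pos
    let c : Fin (m + 1) := ⟨S.card - 1, by omega⟩
    have hc : {c : Fin (m + 1) | ∀ i, x ∉ ⋃ S : Finset ι, ⋃ _ : S.card = c + 1 ∧
        ∃ hS : S.Nonempty, hS.choose = i, W S} ⊆ ((Finset.univ.erase c : Finset (Fin (m + 1))) :
        Set (Fin (m + 1))) := by
      intro c' hc' 
      have : c' ≠ c := by
        rintro rfl
        refine hc' hSne.choose (Set.mem_iUnion.2 ⟨S, Set.mem_iUnion.2 ⟨⟨?_, hSne, rfl⟩, hxS⟩⟩)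
        simp only [c]; omega
      simpa using this
    refine (Set.encard_le_encard hc).trans ?_
    rw [Set.encard_coe_eq_coe_finsetCard]
    simp

/-- Only points missed by exactly m old colours need the new one. Near such a point, with set `A` of
missing colours, the new colour copies an old colour outside `A`. The regions `W A` where this is
done are made open and disjoint by comparing the unions of the colour classes with slightly smaller
sets `G c`. -/
theorem HasDisjointRefinements.option {X ι C : Type*} [TopologicalSpace X] [NormalSpace X]
    {U : ι → Set X} {m : ℕ} [Fintype C] (hC : m < Fintype.card C)
    (h : HasDisjointRefinements U m C) : HasDisjointRefinements U m (Option C) := by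
  classical
  obtain ⟨V, hVo, hVU, hVd, hVm⟩ := h
  have hshr : ∀ A : Finset C, m < A.card → ∃ v : A → Set X, (⋃ c, v c) = Set.univ ∧
      (∀ c, IsOpen (v c)) ∧ ∀ c : A, closure (v c) ⊆ ⋃ i, V c i := fun A hA => by
    refine exists_iUnion_eq_closure_subset (fun c => isOpen_iUnion fun i => hVo c i)
      (fun x => Set.toFinite _) (Set.eq_univ_of_forall fun x => ?_)
    by_contra hx
    simp only [Set.mem_iUnion, not_exists] at hx
    have : (A : Set C).encard ≤ m :=
      (Set.encard_le_encard (t := {c | ∀ i, x ∉ V c i}) fun c hc => hx ⟨c, hc⟩).trans (hVm x)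
    rw [Set.encard_coe_eq_coe_finsetCard] at this
    exact absurd (by exact_mod_cast this) (not_le.2 hA)
  choose v hvc hvo hvV using hshr
  -- Any more than m colours cover the space, so each such family can be shrunk. Uniting the
  -- shrunken sets over all families containing `c` keeps the property that every point is missed by
  -- at most m of the `G c`.
  let G : C → Set X := fun c => ⋃ A : {A : Finset C // m < A.card ∧ c ∈ A}, v A A.2.1 ⟨c, A.2.2⟩
  have hGo : ∀ c, IsOpen (G c) := fun c => isOpen_iUnion fun A => hvo _ _ _
  have hGV : ∀ c, closure (G c) ⊆ ⋃ i, V c i := fun c => by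
    rw [closure_iUnion_of_finite]
    exact Set.iUnion_subset fun A => hvV _ _ ⟨c, A.2.2⟩
  have hGm : ∀ x, (Finset.univ.filter fun c => x ∉ G c).card ≤ m := fun x => by
    by_contra! hlt
    have hx : x ∈ ⋃ c, v _ hlt c := hvc _ hlt ▸ Set.mem_univ x
    obtain ⟨c, hc⟩ := Set.mem_iUnion.1 hx
    have := c.2
    rw [Finset.mem_filter] at this
    exact this.2 (Set.mem_iUnion.2 ⟨⟨_, hlt, c.2⟩, hc⟩)
  let W : Finset C → Set X := fun A => {x | (∀ c ∈ A, x ∉ closure (G c)) ∧ ∀ c ∉ A, x ∈ G c}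
  have hWo : ∀ A, IsOpen (W A) := fun A => by
    have : W A = (⋂ c ∈ A, (closure (G c))ᶜ) ∩ ⋂ c ∈ Aᶜ, G c := by
      ext x; simp [W]
    rw [this]
    exact (isOpen_biInter_finset fun c _ => isClosed_closure.isOpen_compl).inter
      (isOpen_biInter_finset fun c _ => hGo c)
  have hWd : ∀ A B : Finset C, A.card = B.card → ∀ x, x ∈ W A → x ∈ W B → A = B := by
    intro A B hAB x hA hB
    refine Finset.eq_of_subset_of_card_le (fun c hc => ?_) hAB.ge
    by_contra hcB
    exact hA.1 c hc (subset_closure (hB.2 c hcB))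
  have hex : ∀ A : {A : Finset C // A.card = m}, ∃ c, c ∉ A.1 := fun A => by
    by_contra! hc
    have := Finset.eq_univ_iff_forall.2 hc ▸ A.2
    rw [Finset.card_univ] at this
    omega
  choose p hp using hex
  refine ⟨fun o i => o.elim (⋃ A : {A : Finset C // A.card = m}, W A ∩ V (p A) i) (fun c => V c i),
    ?_, ?_, ?_, fun x => ?_⟩
  · rintro (_ | c) i
    · exact isOpen_iUnion fun A => (hWo _).inter (hVo _ _)
    · exact hVo c i
  · rintro (_ | c) i
    · exact Set.iUnion_subset fun A => Set.inter_subset_right.trans (hVU _ _)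
    · exact hVU c i
  · rintro (_ | c) i j x hi hj
    · obtain ⟨A, hA, hi⟩ := Set.mem_iUnion.1 hi
      obtain ⟨B, hB, hj⟩ := Set.mem_iUnion.1 hj
      obtain rfl : A = B := Subtype.ext (hWd A B (A.2.trans B.2.symm) x hA hB)
      exact hVd _ i j x hi hj
    · exact hVd c i j x hi hj
  · let M := Finset.univ.filter fun c => ∀ i, x ∉ V c i
    have hMe : {c | ∀ i, x ∉ V c i} = (M : Set C) := by ext; simp [M]
    have hM : M.card ≤ m := by
      have := hVm x
      rw [hMe, Set.encard_coe_eq_coe_finsetCard] at this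
      exact_mod_cast this
    have hsub : M ⊆ Finset.univ.filter fun c => x ∉ G c := fun c hc => by
      rw [Finset.mem_filter] at hc ⊢
      refine ⟨hc.1, fun hx => ?_⟩
      obtain ⟨i, hi⟩ := Set.mem_iUnion.1 (hGV c (subset_closure hx))
      exact hc.2 i hi
    rcases hM.lt_or_eq with hlt | heq
    · refine (Set.encard_le_encard (t := ((M.map Function.Embedding.some ∪ {none} :
        Finset (Option C)) : Set (Option C))) ?_).trans ?_
      · rintro (_ | c) hc
        · simp
        · simpa [M] using hc
      · rw [Set.encard_coe_eq_coe_finsetCard]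
        have : (M.map Function.Embedding.some ∪ {none} : Finset (Option C)).card ≤ m :=
          (Finset.card_union_le _ _).trans (by simpa using hlt)
        exact_mod_cast this
    -- With m colours already missing, no further `G c` can be missed, so the point lies in `W M`.
    · have hMG : M = Finset.univ.filter fun c => x ∉ G c :=
        Finset.eq_of_subset_of_card_le hsub ((hGm x).trans heq.ge)
      have hxW : x ∈ W M := by
        refine ⟨fun c hc hx => ?_, fun c hc => ?_⟩
        · obtain ⟨i, hi⟩ := Set.mem_iUnion.1 (hGV c hx)
          exact (Finset.mem_filter.1 hc).2 i hi
        · rw [hMG] at hc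
          simpa using hc
      have hpM := hp ⟨M, heq⟩
      obtain ⟨i, hi⟩ : ∃ i, x ∈ V (p ⟨M, heq⟩) i := by
        by_contra! hc
        exact hpM (by simpa [M] using hc)
      refine (Set.encard_le_encard (t := ((M.map Function.Embedding.some :
        Finset (Option C)) : Set (Option C))) ?_).trans ?_
      · rintro (_ | c) hc
        · exact (hc i (Set.mem_iUnion.2 ⟨⟨M, heq⟩, hxW, hi⟩)).elim
        · simpa [M] using hc
      · rw [Set.encard_coe_eq_coe_finsetCard]
        simpa using hM

/-- Ostrand's theorem. -/
theorem hasDisjointRefinements_fin {X ι : Type*} [TopologicalSpace X] [NormalSpace X]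
    [Finite ι] {m : ℕ} (h : topDim X ≤ m) (U : ι → Set X) (hUo : ∀ i, IsOpen (U i))
    (hUc : ∀ x, ∃ i, x ∈ U i) (k : ℕ) : HasDisjointRefinements U m (Fin (m + 1 + k)) := by
  induction k with
  | zero => exact hasDisjointRefinements_of_topDim_le h U hUo hUc
  | succ k ih => exact (ih.option (by simp; omega)).congr (finSuccEquiv _)

/-! ### Dimension of products and cubes -/

theorem exists_finite_ball_cover (X : Type*) [MetricSpace X] [CompactSpace X] {δ : ℝ}
    (hδ : 0 < δ) : ∃ t : Finset X, ∀ x, ∃ y : t, x ∈ Metric.ball (y : X) δ := by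
  obtain ⟨t, -, htf, ht⟩ := (isCompact_univ (X := X)).finite_cover_balls hδ
  refine ⟨htf.toFinset, fun x => ?_⟩
  obtain ⟨y, hy, hx⟩ := Set.mem_iUnion₂.1 (ht (Set.mem_univ x))
  exact ⟨⟨y, by simpa using hy⟩, hx⟩

/-- Both factors are coloured with m + n + 1 colours. A point misses at most m of them in one factor
and n in the other, so some colour serves both; products of sets of one colour are disjoint, so
multiplicity is at most the number of colours. -/
theorem topDim_prod_le {X Y : Type*} [MetricSpace X] [CompactSpace X] [MetricSpace Y]
    [CompactSpace Y] {m n : ℕ} (hX : topDim X ≤ m) (hY : topDim Y ≤ n) :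
    topDim (X × Y) ≤ (m + n : ℕ) := by
  classical
  refine topDim_le_of_shrinking fun N U hUo hUc => ?_
  obtain ⟨δ, hδ, hU⟩ := lebesgue_number_lemma_of_metric (isCompact_univ (X := X × Y)) hUo
    (fun x _ => Set.mem_iUnion.2 (hUc x))
  obtain ⟨s, hs⟩ := exists_finite_ball_cover X hδ
  obtain ⟨t, ht⟩ := exists_finite_ball_cover Y hδ
  obtain ⟨V, hVo, hVU, hVd, hVm⟩ := hasDisjointRefinements_fin hX
    (fun y : s => Metric.ball (y : X) δ) (fun _ => Metric.isOpen_ball) hs n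
  obtain ⟨W, hWo, hWU, hWd, hWm⟩ := (hasDisjointRefinements_fin hY
    (fun y : t => Metric.ball (y : Y) δ) (fun _ => Metric.isOpen_ball) ht m).congr
    (finCongr (show m + 1 + n = n + 1 + m by omega))
  choose φ hφ using fun p : s × t => hU ((p.1 : X), (p.2 : Y)) (Set.mem_univ _)
  refine ⟨fun i => ⋃ c, ⋃ p : s × t, ⋃ _ : φ p = i, V c p.1 ×ˢ W c p.2,
    fun i => isOpen_iUnion fun c => isOpen_iUnion fun p => isOpen_iUnion fun _ =>
      (hVo _ _).prod (hWo _ _), fun x => ?_, fun i => ?_, fun x => ?_⟩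
  · obtain ⟨c, hc⟩ : ∃ c, ¬ ((∀ i, x.1 ∉ V c i) ∨ ∀ i, x.2 ∉ W c i) := by
      by_contra! hc
      have h1 : (Set.univ : Set (Fin (m + 1 + n))).encard ≤ m + n :=
        (Set.encard_le_encard (t := {c | ∀ i, x.1 ∉ V c i} ∪ {c | ∀ i, x.2 ∉ W c i})
          fun c _ => hc c).trans ((Set.encard_union_le _ _).trans (add_le_add (hVm _) (hWm _)))
      rw [Set.encard_univ, ENat.card_eq_coe_fintype_card, Fintype.card_fin] at h1
      have : m + 1 + n ≤ m + n := by exact_mod_cast h1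
      omega
    push Not at hc
    obtain ⟨⟨i, hi⟩, j, hj⟩ := hc
    exact ⟨φ (i, j), Set.mem_iUnion.2 ⟨c, Set.mem_iUnion.2 ⟨(i, j), Set.mem_iUnion.2
      ⟨rfl, hi, hj⟩⟩⟩⟩
  · refine Set.iUnion_subset fun c => Set.iUnion_subset fun p => Set.iUnion_subset fun hp => ?_
    rintro ⟨x, y⟩ ⟨hx, hy⟩
    rw [← hp]
    apply hφ p
    rw [← ball_prod_same]
    exact ⟨hVU _ _ hx, hWU _ _ hy⟩
  · let q : Fin (m + 1 + n) → Option (Fin N) := fun c =>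
      if h : ∃ p : s × t, x ∈ V c p.1 ×ˢ W c p.2 then some (φ h.choose) else none
    have hq : some '' {i | x ∈ ⋃ c, ⋃ p : s × t, ⋃ _ : φ p = i, V c p.1 ×ˢ W c p.2} ⊆
        q '' Set.univ := by
      rintro _ ⟨i, hi, rfl⟩
      simp only [Set.mem_ofPred_eq, Set.mem_iUnion] at hi
      obtain ⟨c, p, rfl, hx⟩ := hi
      have hex : ∃ p : s × t, x ∈ V c p.1 ×ˢ W c p.2 := ⟨p, hx⟩
      refine ⟨c, trivial, ?_⟩
      simp only [q, dif_pos hex]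
      congr 2
      exact Prod.ext (hVd c _ _ _ hex.choose_spec.1 hx.1) (hWd c _ _ _ hex.choose_spec.2 hx.2)
    rw [← (Option.some_injective (Fin N)).encard_image]
    refine (Set.encard_le_encard hq).trans ((Set.encard_image_le _ _).trans ?_)
    rw [Set.encard_univ, ENat.card_eq_coe_fintype_card, Fintype.card_fin]
    have : m + 1 + n ≤ m + n + 1 := by omega
    exact_mod_cast this

theorem topDim_le_zero_of_subsingleton (X : Type*) [TopologicalSpace X] [Subsingleton X] :
    topDim X ≤ (0 : ℕ) := by
  refine topDim_le_of_refinement fun α hα => ?_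
  rcases isEmpty_or_nonempty X with hX | ⟨⟨x⟩⟩
  · exact ⟨Empty, inferInstance, Empty.elim, fun k => k.elim, fun x => isEmptyElim x,
      fun k => k.elim, fun x => isEmptyElim x⟩
  · have : x ∈ ⋃₀ α := hα.covers ▸ Set.mem_univ x
    obtain ⟨W, hW, hx⟩ := this
    refine ⟨Unit, inferInstance, fun _ => W, fun _ => hα.isOpen W hW,
      fun y => ⟨(), Subsingleton.elim x y ▸ hx⟩, fun _ => ⟨W, hW, subset_rfl⟩, fun y => ?_⟩
    refine (Set.encard_le_encard (Set.subset_univ _)).trans ?_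
    simp

theorem topDim_pi_fin_le {X : Type*} [MetricSpace X] [CompactSpace X] {m : ℕ} (hX : topDim X ≤ m)
    (n : ℕ) : topDim (Fin n → X) ≤ (n * m : ℕ) := by
  induction n with
  | zero => simpa using topDim_le_zero_of_subsingleton (Fin 0 → X)
  | succ n ih =>
    have := topDim_prod_le hX ih
    rw [show (n + 1) * m = m + n * m by ring]
    have hc : Continuous fun x : Fin (n + 1) → X => (x 0, fun i : Fin n => x i.succ) := by fun_prop
    refine topDim_le_of_isClosedEmbedding (hc.isClosedEmbedding fun x y hxy => ?_) this
    simp only [Prod.mk.injEq, funext_iff] at hxy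
    exact funext (Fin.cases hxy.1 hxy.2)

theorem topDim_unitInterval_le : topDim unitInterval ≤ (1 : ℕ) := by
  refine topDim_le_of_refinement fun α hα => ?_
  obtain ⟨δ, hδ, hU⟩ := lebesgue_number_lemma_of_metric_sUnion (isCompact_univ (X := unitInterval))
    (fun U hU => hα.isOpen U hU) (hα.covers ▸ subset_rfl)
  obtain ⟨N, hN⟩ := exists_nat_one_div_lt hδ
  have hN0 : (0 : ℝ) < N + 1 := by positivity
  -- Intervals of radius 1/(N + 1) about the points k/(N + 1): a point lies in at most the two with
  -- k its scaled floor or the next integer.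
  refine ⟨Fin (N + 2), inferInstance, fun k => {x | |(N + 1) * (x : ℝ) - k| < 1}, fun k => ?_,
    fun x => ?_, fun k => ?_, fun x => ?_⟩
  · exact isOpen_lt (by fun_prop) continuous_const
  · have hx := mul_le_mul_of_nonneg_left x.2.2 hN0.le
    have hx0 := mul_nonneg hN0.le x.2.1
    refine ⟨⟨⌊(N + 1) * (x : ℝ)⌋₊, ?_⟩, ?_⟩
    · rw [Nat.floor_lt hx0]
      push_cast; linarith
    · have h1 := Nat.floor_le hx0
      have h2 := Nat.lt_floor_add_one ((N + 1) * (x : ℝ))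
      simp only [Set.mem_ofPred_eq, abs_lt]
      constructor <;> linarith
  · have hk : (k : ℝ) ≤ N + 1 := by
      have := k.is_le
      exact_mod_cast this
    let y : unitInterval := ⟨k / (N + 1), by positivity, (div_le_one hN0).2 hk⟩
    obtain ⟨U, hUα, hyU⟩ := hU y (Set.mem_univ _)
    refine ⟨U, hUα, fun x hx => hyU ?_⟩
    rw [Metric.mem_ball, Subtype.dist_eq, Real.dist_eq]
    refine lt_trans ?_ hN
    have : (x : ℝ) - y = ((N + 1) * (x : ℝ) - k) / (N + 1) := by
      simp only [y]; field_simp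
    rw [this, abs_div, abs_of_pos hN0]
    gcongr
    exact hx
  · have : {k : Fin (N + 2) | x ∈ {x : unitInterval | |(N + 1) * (x : ℝ) - k| < 1}} ⊆
        Fin.val ⁻¹' (({⌊(N + 1) * (x : ℝ)⌋₊, ⌊(N + 1) * (x : ℝ)⌋₊ + 1} : Finset ℕ) : Set ℕ) := by
      intro k hk
      have hx0 := mul_nonneg hN0.le x.2.1
      have h1 := Nat.floor_le hx0
      have h2 := Nat.lt_floor_add_one ((N + 1) * (x : ℝ))
      have hk : |(N + 1) * (x : ℝ) - k| < 1 := hk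
      rw [abs_lt] at hk
      have h3 : (k : ℕ) < ⌊(N + 1) * (x : ℝ)⌋₊ + 2 := by
        have : (k : ℝ) < ⌊(N + 1) * (x : ℝ)⌋₊ + 2 := by linarith
        exact_mod_cast this
      have h4 : ⌊(N + 1) * (x : ℝ)⌋₊ < (k : ℕ) + 1 := by
        have : (⌊(N + 1) * (x : ℝ)⌋₊ : ℝ) < k + 1 := by linarith
        exact_mod_cast this
      simp only [Set.mem_preimage, Finset.coe_insert, Finset.coe_singleton, Set.mem_insert_iff,
        Set.mem_singleton_iff]
      omega
    refine (Set.encard_le_encard this).trans ?_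
    rw [← (Fin.val_injective).encard_image]
    refine (Set.encard_le_encard (Set.image_preimage_subset _ _)).trans ?_
    rw [Set.encard_coe_eq_coe_finsetCard]
    exact_mod_cast Finset.card_le_two

/-! ### Kuhn's lemma and the Poincaré–Miranda theorem -/

/-- Sperner's parity count: in a fully labelled simplex only the facet opposite the vertex labelled
n qualifies. Otherwise qualifying facets, if any, form a pair obtained by dropping either of two
vertices with a common label. -/
theorem sum_facets_eq {n : ℕ} (f : ℕ → ℕ) (hf : ∀ k, f k ≤ n) :
    ∑ j ∈ Finset.range (n + 1),
      (if ((Finset.range (n + 1)).erase j).image f = Finset.range n then 1 else 0 : ZMod 2) =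
      if (Finset.range (n + 1)).image f = Finset.range (n + 1) then 1 else 0 := by
  classical
  split_ifs with hfull
  · have hinj : Set.InjOn f (Finset.range (n + 1)) :=
      Finset.card_image_iff.1 (by rw [hfull])
    obtain ⟨j₀, hj₀, hfj₀⟩ := Finset.mem_image.1 (hfull ▸ Finset.self_mem_range_succ n)
    rw [Finset.sum_eq_single_of_mem j₀ hj₀, if_pos]
    · ext a
      simp only [Finset.mem_image, Finset.mem_erase]
      constructor
      · rintro ⟨k, ⟨hk, hkn⟩, rfl⟩
        refine Finset.mem_range.2 (lt_of_le_of_ne (hf k) fun h => hk (hinj hkn hj₀ ?_))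
        rw [h, hfj₀]
      · intro ha
        have ha' := Finset.mem_range.1 ha
        obtain ⟨k, hk, rfl⟩ := Finset.mem_image.1 (hfull.symm ▸ Finset.mem_range.2 (by omega) :
          a ∈ (Finset.range (n + 1)).image f)
        exact ⟨k, ⟨by rintro rfl; omega, hk⟩, rfl⟩
    · intro j hj hne
      refine if_neg fun h => ?_
      have : f j₀ ∈ ((Finset.range (n + 1)).erase j).image f :=
        Finset.mem_image_of_mem _ (Finset.mem_erase.2 ⟨hne.symm, hj₀⟩)
      rw [h, hfj₀] at this
      simp at this
  · by_cases hex : ∃ j ∈ Finset.range (n + 1),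
      ((Finset.range (n + 1)).erase j).image f = Finset.range n
    · obtain ⟨j, hj, hjn⟩ := hex
      have hfj : f j ∈ Finset.range n := by
        by_contra hlt
        refine hfull ?_
        have : f j = n := le_antisymm (hf j) (by simpa using hlt)
        rw [← Finset.insert_erase hj, Finset.image_insert, hjn, this, Finset.insert_erase hj,
          Finset.range_add_one]
      obtain ⟨k, hk, hkj⟩ := Finset.mem_image.1 (hjn.symm ▸ hfj :
        f j ∈ ((Finset.range (n + 1)).erase j).image f)
      obtain ⟨hkne, hkn⟩ := Finset.mem_erase.1 hk
      have hkk : ((Finset.range (n + 1)).erase k).image f = Finset.range n := by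
        rw [← hjn]
        ext a
        simp only [Finset.mem_image, Finset.mem_erase]
        constructor
        · rintro ⟨b, ⟨hb, hbn⟩, rfl⟩
          by_cases h : b = j
          · exact ⟨k, ⟨hkne, hkn⟩, h ▸ hkj⟩
          · exact ⟨b, ⟨h, hbn⟩, rfl⟩
        · rintro ⟨b, ⟨hb, hbn⟩, rfl⟩
          by_cases h : b = k
          · exact ⟨j, ⟨hkne.symm, hj⟩, h ▸ hkj.symm⟩
          · exact ⟨b, ⟨h, hbn⟩, rfl⟩
      rw [← Finset.sum_subset (s₁ := {j, k}), Finset.sum_pair hkne.symm, if_pos hjn, if_pos hkk]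
      · rfl
      · intro a ha
        rcases Finset.mem_insert.1 ha with rfl | ha
        · exact hj
        · rw [Finset.mem_singleton.1 ha]; exact hkn
      · intro a ha hne
        simp only [Finset.mem_insert, Finset.mem_singleton, not_or] at hne
        refine if_neg fun h => hkne ?_
        have hinj : Set.InjOn f ((Finset.range (n + 1)).erase a) :=
          Finset.card_image_iff.1 (by rw [h, Finset.card_erase_of_mem ha]; simp)
        exact hinj (Finset.mem_coe.2 (Finset.mem_erase.2 ⟨Ne.symm hne.2, hkn⟩))
          (Finset.mem_coe.2 (Finset.mem_erase.2 ⟨Ne.symm hne.1, hj⟩)) hkj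
    · push Not at hex
      exact Finset.sum_eq_zero fun j hj => if_neg (hex j hj)

/-- The `k`-th vertex of the simplex with least vertex `v` and order of directions `σ` in Kuhn's
triangulation of the grid. -/
def kuhnVertex {n : ℕ} (v : Fin n → ℕ) (σ : Equiv.Perm (Fin n)) (k : ℕ) : Fin n → ℕ :=
  fun i => v i + if (σ i : ℕ) < k then 1 else 0

/-- Facets interior in direction i are counted twice and cancel mod 2; the lower layer vanishes by
`hB`, which leaves the upper layer. -/
theorem sum_box_shift {n N : ℕ} (i : Fin n) (B : (Fin n → ℕ) → ZMod 2)
    (hB : ∀ v, v i = 0 → B v = 0) :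
    ∑ v ∈ Fintype.piFinset fun _ : Fin n => Finset.range N, (B (v + Pi.single i 1) + B v) =
      ∑ v ∈ (Fintype.piFinset fun _ : Fin n => Finset.range N) with v i + 1 = N,
        B (v + Pi.single i 1) := by
  classical
  rw [Finset.sum_add_distrib]
  have h1 : ∑ v ∈ Fintype.piFinset fun _ : Fin n => Finset.range N, B v =
      ∑ v ∈ (Fintype.piFinset fun _ : Fin n => Finset.range N) with ¬ v i + 1 = N,
        B (v + Pi.single i 1) := by
    rw [← Finset.sum_filter_add_sum_filter_not _ (fun v => v i = 0), Finset.sum_eq_zero, zero_add]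
    · symm
      refine Finset.sum_nbij' (fun v => v + Pi.single i 1) (fun v => v - Pi.single i 1) ?_ ?_ ?_ ?_
        ?_
      · intro v hv
        simp only [Finset.mem_filter, Fintype.mem_piFinset, Finset.mem_range, Pi.add_apply,
          Pi.single_apply] at hv ⊢
        refine ⟨fun a => ?_, by simp⟩
        have := hv.1 a
        split_ifs with h
        · subst h; omega
        · omega
      · intro v hv
        simp only [Finset.mem_filter, Fintype.mem_piFinset, Finset.mem_range, Pi.sub_apply,
          Pi.single_apply] at hv ⊢
        refine ⟨fun a => ?_, ?_⟩
        · have := hv.1 a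
          omega
        · have := hv.1 i
          simp; omega
      · intro v _; simp
      · intro v hv
        simp only [Finset.mem_filter] at hv
        ext a
        simp only [Pi.add_apply, Pi.sub_apply, Pi.single_apply]
        split_ifs with h
        · subst h; omega
        · omega
      · intro v _; rfl
    · intro v hv
      exact hB v (Finset.mem_filter.1 hv).2
  rw [h1, ← Finset.sum_filter_add_sum_filter_not _ (fun v => v i + 1 = N), add_assoc,
    CharTwo.add_self_eq_zero, add_zero]

/-- The number of fully labelled simplices is odd, by induction on n. Count pairs of a simplex and a
facet labelled 0, …, n − 1: interior facets cancel, and the label conditions exclude boundary facets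
except on the face where coordinate 0 equals N. There the labelling satisfies the same conditions
one dimension lower, which is why the indices in `htop` and `hbot` run backwards. -/
theorem sum_kuhn_eq_one {N : ℕ} (hN : 0 < N) (n : ℕ) (l : (Fin n → ℕ) → ℕ) (hl : ∀ x, l x ≤ n)
    (htop : ∀ (x : Fin n → ℕ) (i : Fin n), x i = N → l x + i < n) (hbot : ∀ (x : Fin n → ℕ) (i : Fin n), x i = 0 → l x + i + 1 ≠ n) :
    ∑ v ∈ Fintype.piFinset fun _ : Fin n => Finset.range N, ∑ σ : Equiv.Perm (Fin n),
      (if (Finset.range (n + 1)).image (fun k => l (kuhnVertex v σ k)) = Finset.range (n + 1)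
        then 1 else 0 : ZMod 2) = 1 := by
  classical
  induction n with
  | zero =>
    have : ∀ x, l x = 0 := fun x => Nat.le_zero.1 (hl x)
    simp [this]
  | succ n ih =>
    let M : (Fin (n + 1) → ℕ) → Equiv.Perm (Fin (n + 1)) → ℕ → ZMod 2 := fun v σ j =>
      if ((Finset.range (n + 1 + 1)).erase j).image (fun k => l (kuhnVertex v σ k)) =
        Finset.range (n + 1) then 1 else 0
    have hinterior : ∀ v, ∀ j ∈ Finset.range n, ∑ σ, M v σ (j + 1) = 0 := by
      intro v j hj
      have hj := Finset.mem_range.1 hj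
      -- Exchanging the consecutive directions j and j + 1 moves only the vertex j + 1, which is the
      -- omitted one.
      let a : Fin (n + 1) := ⟨j, by omega⟩
      let b : Fin (n + 1) := ⟨j + 1, by omega⟩
      have hab : a ≠ b := by simp [a, b]
      refine Finset.sum_involution (fun σ _ => Equiv.swap a b * σ) ?_ ?_ (by simp) ?_
      · intro σ _
        have : M v (Equiv.swap a b * σ) (j + 1) = M v σ (j + 1) := by
          simp only [M]
          congr 2
          refine Finset.image_congr fun k hk => ?_
          have hk : k ≠ j + 1 := (Finset.mem_erase.1 hk).1
          refine congrArg l ?_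
          ext i
          simp only [kuhnVertex, Equiv.Perm.mul_apply]
          congr 1
          refine if_congr ?_ rfl rfl
          rw [Equiv.swap_apply_def]
          split_ifs with h1 h2
          · rw [h1]; simp only [a, b]; omega
          · rw [h2]; simp only [a, b]; omega
          · rfl
        rw [this, CharTwo.add_self_eq_zero]
      · intro σ _ _ h
        have : Equiv.swap a b = 1 := mul_eq_right.1 h
        exact hab (Equiv.swap_eq_one_iff.1 this)
      · intro σ _
        rw [← mul_assoc, Equiv.swap_mul_self, one_mul]
    have hM0 : ∀ v σ, M v σ 0 = if (Finset.range (n + 1)).image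
        (fun k => l (kuhnVertex v σ (k + 1))) = Finset.range (n + 1) then 1 else 0 := by
      intro v σ
      simp only [M]
      congr 2
      rw [show (fun k => l (kuhnVertex v σ (k + 1))) =
        (fun k => l (kuhnVertex v σ k)) ∘ fun k => k + 1 from rfl, ← Finset.image_image]
      congr 1
      ext k
      simp only [Finset.mem_erase, Finset.mem_range, Finset.mem_image]
      constructor
      · rintro ⟨h1, h2⟩
        exact ⟨k - 1, by omega, by omega⟩
      · rintro ⟨a, h1, rfl⟩
        exact ⟨by omega, by omega⟩
    have hMlast : ∀ v σ, M v σ (n + 1) = if (Finset.range (n + 1)).image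
        (fun k => l (kuhnVertex v σ k)) = Finset.range (n + 1) then 1 else 0 := by
      intro v σ
      simp only [M]
      congr 3
      rw [Finset.range_add_one, Finset.erase_insert (by simp)]
    -- The facet without its first vertex is also the facet without the last vertex of the
    -- neighbouring simplex, whose first direction has been moved to the end; `r` performs this
    -- rotation.
    let r : Equiv.Perm (Fin (n + 1)) := (finRotate (n + 1)).symm
    have hr : ∀ x : Fin (n + 1), x ≠ 0 → ((r x : Fin (n + 1)) : ℕ) + 1 = x := by
      intro x hx
      obtain ⟨y, rfl⟩ := (finRotate (n + 1)).surjective x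
      have hy : y ≠ Fin.last n := by
        rintro rfl
        exact hx finRotate_last
      simp only [r, Equiv.symm_apply_apply]
      rw [coe_finRotate_of_ne_last hy]
    have hr0 : r 0 = Fin.last n := by
      rw [Equiv.symm_apply_eq, finRotate_last]
    have hshift : ∀ v σ, M v σ 0 = M (v + Pi.single (σ.symm 0) 1) (r * σ) (n + 1) := by
      intro v σ
      rw [hM0, hMlast]
      congr 2
      refine Finset.image_congr fun k hk => ?_
      have hk : k < n + 1 := Finset.mem_range.1 hk
      refine congrArg l ?_
      ext i
      simp only [kuhnVertex, Pi.add_apply, Pi.single_apply]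
      by_cases hi : i = σ.symm 0
      · have h1 : σ i = 0 := by rw [hi]; simp
        have h2 : (r * σ) i = Fin.last n := by rw [Equiv.Perm.mul_apply, h1, hr0]
        rw [if_pos hi, if_pos (by rw [h1]; simp), if_neg (by rw [h2, Fin.val_last]; omega)]
      · have h1 : σ i ≠ 0 := fun h => hi (by rw [← h]; simp)
        have h2 : (((r * σ) i : Fin (n + 1)) : ℕ) + 1 = σ i := hr _ h1
        rw [if_neg hi, add_zero]
        congr 1
        exact if_congr (by omega) rfl rfl
    have hlow : ∀ σ : Equiv.Perm (Fin (n + 1)), ∀ v : Fin (n + 1) → ℕ, v (σ.symm 0) = 0 →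
        M v (r * σ) (n + 1) = 0 := by
      intro σ v hv
      rw [hMlast]
      refine if_neg fun h => ?_
      have hlt := (σ.symm 0).is_lt
      obtain ⟨k, hk, hkl⟩ := Finset.mem_image.1 (h.symm ▸ Finset.mem_range.2 (by omega) :
        n - (σ.symm 0 : Fin (n + 1)) ∈ _)
      refine hbot (kuhnVertex v (r * σ) k) (σ.symm 0) ?_ (by omega)
      have hk := Finset.mem_range.1 hk
      simp only [kuhnVertex, hv, Equiv.Perm.mul_apply, Equiv.apply_symm_apply, hr0,
        Fin.val_last]
      rw [if_neg (by omega)]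
    have hhigh : ∀ σ : Equiv.Perm (Fin (n + 1)), ∀ v : Fin (n + 1) → ℕ, v (σ.symm 0) + 1 = N →
        σ 0 ≠ 0 → M v σ 0 = 0 := by
      intro σ v hv hσ
      rw [hM0]
      refine if_neg fun h => ?_
      obtain ⟨k, hk, hkl⟩ := Finset.mem_image.1 (h.symm ▸ Finset.self_mem_range_succ n :
        n ∈ _)
      have h1 := htop (kuhnVertex v σ (k + 1)) (σ.symm 0) (by simp [kuhnVertex, hv])
      have h2 : σ.symm 0 ≠ 0 := fun h => hσ ((Equiv.symm_apply_eq σ).1 h).symm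
      have h3 := Fin.pos_of_ne_zero h2
      rw [Fin.lt_def] at h3
      simp only [Fin.val_zero] at h3
      omega
    calc _ = ∑ v ∈ Fintype.piFinset fun _ : Fin (n + 1) => Finset.range N,
          ∑ σ, ∑ j ∈ Finset.range (n + 1 + 1), M v σ j := by
          refine Finset.sum_congr rfl fun v _ => Finset.sum_congr rfl fun σ _ => ?_
          exact (sum_facets_eq _ fun k => hl _).symm
      _ = ∑ v ∈ Fintype.piFinset fun _ : Fin (n + 1) => Finset.range N,
          ∑ σ, (M v σ 0 + M v (r * σ) (n + 1)) := by
          refine Finset.sum_congr rfl fun v _ => ?_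
          simp_rw [Finset.sum_range_succ _ (n + 1), Finset.sum_range_succ' _ n]
          rw [Finset.sum_add_distrib, Finset.sum_add_distrib, Finset.sum_comm,
            Finset.sum_eq_zero (hinterior v), zero_add, Finset.sum_add_distrib]
          congr 1
          exact (Equiv.sum_comp (Equiv.mulLeft r) fun σ => M v σ (n + 1)).symm
      _ = ∑ σ, ∑ v ∈ (Fintype.piFinset fun _ : Fin (n + 1) => Finset.range N) with
            v (σ.symm 0) + 1 = N, M v σ 0 := by
          rw [Finset.sum_comm]
          refine Finset.sum_congr rfl fun σ _ => ?_
          simp_rw [hshift]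
          exact sum_box_shift (σ.symm 0) (fun v => M v (r * σ) (n + 1)) (hlow σ)
      _ = ∑ τ : Equiv.Perm (Fin n),
          ∑ v ∈ (Fintype.piFinset fun _ : Fin (n + 1) => Finset.range N) with
            v 0 + 1 = N, M v (Equiv.Perm.decomposeFin.symm (0, τ)) 0 := by
          rw [← Equiv.Perm.decomposeFin.symm.sum_comp, Fintype.sum_prod_type,
            Finset.sum_eq_single_of_mem 0 (Finset.mem_univ _)]
          · refine Finset.sum_congr rfl fun τ _ => ?_
            have : (Equiv.Perm.decomposeFin.symm (0, τ)).symm 0 = 0 := by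
              rw [Equiv.symm_apply_eq, Equiv.Perm.decomposeFin_symm_apply_zero]
            rw [this]
          · intro p _ hp
            refine Finset.sum_eq_zero fun τ _ => Finset.sum_eq_zero fun v hv => ?_
            refine hhigh _ v (Finset.mem_filter.1 hv).2 ?_
            rwa [Equiv.Perm.decomposeFin_symm_apply_zero]
      _ = ∑ τ : Equiv.Perm (Fin n), ∑ w ∈ Fintype.piFinset fun _ : Fin n => Finset.range N,
          (if (Finset.range (n + 1)).image (fun k => l (Fin.cons N (kuhnVertex w τ k))) =
            Finset.range (n + 1) then 1 else 0 : ZMod 2) := by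
          refine Finset.sum_congr rfl fun τ _ => ?_
          refine Finset.sum_nbij' (fun v => Fin.tail v) (fun w => Fin.cons (N - 1) w) ?_ ?_ ?_ ?_ ?_
          · intro v hv
            simp only [Finset.mem_filter, Fintype.mem_piFinset] at hv ⊢
            exact fun i => hv.1 i.succ
          · intro w hw
            simp only [Finset.mem_filter, Fintype.mem_piFinset, Finset.mem_range] at hw ⊢
            refine ⟨Fin.cases (by simp; omega) (by simpa using hw), by simp; omega⟩
          · intro v hv
            have := (Finset.mem_filter.1 hv).2
            rw [show N - 1 = v 0 by omega, Fin.cons_self_tail]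
          · intro w hw; simp
          · intro v hv
            have hv := (Finset.mem_filter.1 hv).2
            rw [hM0]
            congr 2
            refine Finset.image_congr fun k _ => ?_
            refine congrArg l ?_
            refine funext (Fin.cases ?_ fun i => ?_)
            · simp [kuhnVertex, hv]
            · simp [kuhnVertex, Fin.tail]
      _ = 1 := by
          rw [Finset.sum_comm]
          refine ih (fun w => l (Fin.cons N w)) (fun w => ?_) (fun w i hw => ?_) (fun w i hw => ?_)
          · have := htop (Fin.cons N w) 0 rfl
            simp only [Fin.val_zero] at this
            omega
          · have := htop (Fin.cons N w) i.succ (by simpa using hw)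
            simp only [Fin.val_succ] at this
            omega
          · have := hbot (Fin.cons N w) i.succ (by simpa using hw)
            simp only [Fin.val_succ] at this
            omega

theorem exists_kuhn_simplex {N : ℕ} (hN : 0 < N) {n : ℕ} (l : (Fin n → ℕ) → ℕ) (hl : ∀ x, l x ≤ n)
    (htop : ∀ (x : Fin n → ℕ) (i : Fin n), x i = N → l x + i < n) (hbot : ∀ (x : Fin n → ℕ) (i : Fin n), x i = 0 → l x + i + 1 ≠ n) :
    ∃ v : Fin n → ℕ, ∀ j ≤ n, ∃ x : Fin n → ℕ, (∀ i, v i ≤ x i ∧ x i ≤ v i + 1) ∧ l x = j := by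
  have h := sum_kuhn_eq_one hN n l hl htop hbot
  obtain ⟨v, -, hv⟩ := Finset.exists_ne_zero_of_sum_ne_zero (h.trans_ne one_ne_zero)
  obtain ⟨σ, -, hσ⟩ := Finset.exists_ne_zero_of_sum_ne_zero hv
  have hσ := (ite_ne_right_iff.1 hσ).1
  refine ⟨v, fun j hj => ?_⟩
  obtain ⟨k, -, hk⟩ := Finset.mem_image.1 (hσ.symm ▸ Finset.mem_range.2 (by omega) : j ∈ _)
  refine ⟨kuhnVertex v σ k, fun i => ?_, hk⟩
  simp only [kuhnVertex]
  split_ifs <;> omega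

/-- A form of the Poincaré–Miranda theorem. -/
theorem exists_forall_eq_half {n : ℕ} (h : Fin n → C(Fin n → unitInterval, ℝ))
    (h0 : ∀ i x, x i = 0 → h i x = 0) (h1 : ∀ i x, x i = 1 → h i x = 1) :
    ∃ x, ∀ i, h i x = 1 / 2 := by
  by_contra! hne
  let φ : (Fin n → unitInterval) → ℝ := fun x => ∑ i, |h i x - 1 / 2|
  have hφc : Continuous φ := by fun_prop
  obtain ⟨x₀, -, hx₀⟩ := isCompact_univ.exists_isMinOn Set.univ_nonempty hφc.continuousOn
  have hpos : 0 < φ x₀ := by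
    obtain ⟨i, hi⟩ := hne x₀
    exact (abs_pos.2 (sub_ne_zero.2 hi)).trans_le
      (Finset.single_le_sum (f := fun i => |h i x₀ - 1 / 2|) (fun i _ => abs_nonneg _)
        (Finset.mem_univ i))
  have huc : UniformContinuous fun x (i : Fin n) => h i x :=
    CompactSpace.uniformContinuous_of_continuous (by fun_prop)
  -- With this tolerance n deviations add up to less than the minimum `φ x₀`.
  obtain ⟨δ, hδ, hδh⟩ := Metric.uniformContinuous_iff.1 huc (φ x₀ / (n + 1)) (by positivity)
  obtain ⟨N, hN⟩ := exists_nat_one_div_lt hδ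
  have hN0 : (0 : ℝ) < N + 1 := by positivity
  let p : (Fin n → ℕ) → Fin n → unitInterval := fun x i =>
    Set.projIcc 0 1 zero_le_one ((x i : ℝ) / (N + 1))
  -- The label of a grid point is the least j for which `h i` exceeds 1/2 with i = n − 1 − j, and n
  -- if there is none.
  let S : (Fin n → ℕ) → Set ℕ := fun x => {j | j = n ∨ ∃ i : Fin n, i + j + 1 = n ∧ 1 / 2 < h i (p x)}
  have hS : ∀ x, sInf (S x) ∈ S x := fun x => Nat.sInf_mem ⟨n, Or.inl rfl⟩
  have hle : ∀ x, ∀ j ∈ S x, sInf (S x) ≤ j := fun x j hj => Nat.sInf_le hj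
  obtain ⟨v, hv⟩ := exists_kuhn_simplex (N := N + 1) (by omega) (fun x => sInf (S x))
    (fun x => hle x n (Or.inl rfl))
    (fun x i hi => by
      have hpx : p x i = 1 := by
        simp only [p, hi]
        push_cast
        rw [div_self hN0.ne', Set.projIcc_right]; rfl
      have := hle x (n - 1 - i) (Or.inr ⟨i, by omega, by rw [h1 i _ hpx]; norm_num⟩)
      have := i.is_lt
      omega)
    (fun x i hi hl => by
      have hpx : p x i = 0 := by
        simp only [p, hi]
        rw [Nat.cast_zero, zero_div, Set.projIcc_left]; rfl
      rcases hS x with h' | ⟨j, hj, hj'⟩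
      · omega
      · obtain rfl : i = j := Fin.ext (by omega)
        rw [h0 i _ hpx] at hj'
        norm_num at hj')
  obtain ⟨y, hy, hyn⟩ := hv n le_rfl
  have hyle : ∀ i, h i (p y) ≤ 1 / 2 := fun i => by
    by_contra! hlt
    have := hle y (n - 1 - i) (Or.inr ⟨i, by omega, hlt⟩)
    have := i.is_lt
    omega
  have hdist : ∀ x : Fin n → ℕ, (∀ i, v i ≤ x i ∧ x i ≤ v i + 1) → dist (p x) (p y) < δ := by
    intro x hx
    refine (dist_pi_lt_iff hδ).2 fun i => lt_of_le_of_lt ?_ hN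
    refine (LipschitzWith.projIcc zero_le_one).dist_le_mul _ _ |>.trans ?_
    rw [NNReal.coe_one, one_mul, Real.dist_eq, ← sub_div, abs_div, abs_of_pos hN0]
    gcongr
    obtain ⟨h1, h2⟩ := hx i
    obtain ⟨h3, h4⟩ := hy i
    have h1' : (v i : ℝ) ≤ x i := by exact_mod_cast h1
    have h2' : (x i : ℝ) ≤ v i + 1 := by exact_mod_cast h2
    have h3' : (v i : ℝ) ≤ y i := by exact_mod_cast h3
    have h4' : (y i : ℝ) ≤ v i + 1 := by exact_mod_cast h4
    rw [abs_le]; constructor <;> linarith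
  have hsmall : ∀ i, |h i (p y) - 1 / 2| ≤ φ x₀ / (n + 1) := fun i => by
    obtain ⟨x, hx, hxl⟩ := hv (n - 1 - i) (by omega)
    have hxi : 1 / 2 < h i (p x) := by
      rcases hS x with h' | ⟨j, hj, hj'⟩
      · have := i.is_lt; omega
      · obtain rfl : i = j := Fin.ext (by have := i.is_lt; omega)
        exact hj'
    have := (dist_pi_lt_iff (by positivity)).1 (hδh (hdist x hx)) i
    rw [Real.dist_eq, abs_lt] at this
    have := hyle i
    rw [abs_le]; constructor <;> linarith
  have hφy : φ (p y) ≤ n * (φ x₀ / (n + 1)) := by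
    refine (Finset.sum_le_card_nsmul _ _ _ fun i _ => hsmall i).trans ?_
    simp
  have hlt : n * (φ x₀ / (n + 1)) < φ x₀ := by
    rw [mul_div_assoc', div_lt_iff₀ (by positivity)]
    nlinarith
  exact absurd (hx₀ (Set.mem_univ (p y))) (not_le.2 (hφy.trans_lt hlt))

/-- Lebesgue's covering theorem for maps. -/
theorem card_le_topDim_of_fin {n k : ℕ} {Q : Type*} [MetricSpace Q] [CompactSpace Q]
    (f : C(Fin n → unitInterval, Q)) (hf : ∀ x y i, f x = f y → x i = 0 → y i ≠ 1)
    (hQ : topDim Q ≤ k) : n ≤ k := by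
  by_contra! hkn
  have hcl : ∀ i (b : Bool), IsClosed (f '' {x | x i = if b then 1 else 0}) := fun i b =>
    ((isClosed_eq (continuous_apply i) continuous_const).isCompact.image f.continuous).isClosed
  -- `O s` avoids the image of one face in each direction. These sets cover because no point is in
  -- the images of two opposite faces.
  let O : (Fin n → Bool) → Set Q := fun s => ⋂ i, (f '' {x | x i = if s i then 1 else 0})ᶜ
  have hOo : ∀ s, IsOpen (O s) := fun s => isOpen_iInter_of_finite fun i => (hcl i _).isOpen_compl
  have hOc : ∀ q, ∃ s, q ∈ O s := fun q => by
    have : ∀ i, ∃ b : Bool, q ∉ f '' {x | x i = if b then 1 else 0} := fun i => by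
      by_contra! hc
      obtain ⟨x, hx, hxq⟩ := hc false
      obtain ⟨y, hy, hyq⟩ := hc true
      exact hf x y i (hxq.trans hyq.symm) (by simpa using hx) (by simpa using hy)
    choose s hs using this
    exact ⟨s, Set.mem_iInter.2 hs⟩
  obtain ⟨V, hVo, hVO, hVd, hVm⟩ := hasDisjointRefinements_of_topDim_le hQ O hOo hOc
  have hVc : ∀ q, ∃ p : Fin (k + 1) × (Fin n → Bool), q ∈ V p.1 p.2 := fun q => by
    by_contra! hc
    have h1 : (Set.univ : Set (Fin (k + 1))).encard ≤ k :=
      (Set.encard_le_encard fun c _ i => hc (c, i)).trans (hVm q)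
    rw [Set.encard_univ, ENat.card_eq_coe_fintype_card, Fintype.card_fin] at h1
    have : k + 1 ≤ k := by exact_mod_cast h1
    omega
  obtain ⟨F, hFc, hFcl, hFV⟩ := exists_iUnion_eq_closed_subset
    (u := fun p : Fin (k + 1) × (Fin n → Bool) => V p.1 p.2)
    (fun p => hVo _ _) (fun _ => Set.toFinite _) (Set.eq_univ_of_forall fun q => Set.mem_iUnion.2 (hVc q))
  have hface : ∀ s c x (i : Fin n), f x ∈ F (c, s) → x i ≠ if s i then 1 else 0 := by
    intro s c x i hx hxi
    exact Set.mem_iInter.1 (hVO _ _ (hFV _ hx)) i ⟨x, hxi, rfl⟩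
  -- Direction i is paired with colour i: `g i` is 0 or 1 on each closed set of that colour and has
  -- the prescribed values on the two faces. Disjointness within the colour makes this possible. As
  -- there are only k + 1 ≤ n colours, every point has some `g i` different from 1/2, contrary to
  -- Poincaré–Miranda.
  have hury : ∀ i : Fin n, ∃ g : C(Fin n → unitInterval, ℝ), (∀ x, x i = 0 → g x = 0) ∧
      (∀ x, x i = 1 → g x = 1) ∧ ∀ hi : (i : ℕ) < k + 1, ∀ s, ∀ x, f x ∈ F (⟨i, hi⟩, s) →
        g x ≠ 1 / 2 := by
    intro i
    by_cases hi : (i : ℕ) < k + 1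
    · let B : Bool → Set (Fin n → unitInterval) := fun b => {x | x i = if b then 1 else 0} ∪
        ⋃ s : Fin n → Bool, ⋃ _ : s i = !b, f ⁻¹' F (⟨i, hi⟩, s)
      have hBcl : ∀ b, IsClosed (B b) := fun b =>
        (isClosed_eq (continuous_apply i) continuous_const).union
          (isClosed_iUnion_of_finite fun s => isClosed_iUnion_of_finite fun _ =>
          (hFcl _).preimage f.continuous)
      have hBd : Disjoint (B false) (B true) := by
        rw [Set.disjoint_left]
        rintro x hx hy
        simp only [B, Set.mem_union, Set.mem_iUnion] at hx hy
        rcases hx with hx | ⟨s, hs, hx⟩ <;> rcases hy with hy | ⟨t, ht, hy⟩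
        · have hx : x i = 0 := by simpa using hx
          have hy : x i = 1 := by simpa using hy
          exact zero_ne_one (hx.symm.trans hy)
        · exact hface t _ x i hy (by rw [ht]; simpa using hx)
        · exact hface s _ x i hx (by rw [hs]; simpa using hy)
        · obtain rfl : s = t := hVd ⟨i, hi⟩ _ _ _ (hFV (⟨i, hi⟩, s) hx) (hFV (⟨i, hi⟩, t) hy)
          rw [hs] at ht
          simp at ht
      obtain ⟨g, hg0, hg1, -⟩ := exists_continuous_zero_one_of_isClosed (hBcl false) (hBcl true) hBd
      refine ⟨g, fun x hx => hg0 (Or.inl (by simpa using hx)),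
        fun x hx => hg1 (Or.inl (by simpa using hx)), fun _ s x hx => ?_⟩
      have hmem : x ∈ B (!s i) := Or.inr (Set.mem_iUnion₂.2 ⟨s, by simp, hx⟩)
      cases hsi : s i <;> rw [hsi] at hmem
      · rw [hg1 hmem]; norm_num
      · rw [hg0 hmem]; norm_num
    · exact ⟨⟨fun x => x i, by fun_prop⟩, fun x hx => by simp [hx], fun x hx => by simp [hx],
        fun h => absurd h hi⟩
  choose g hg0 hg1 hgF using hury
  obtain ⟨x, hx⟩ := exists_forall_eq_half g hg0 hg1
  obtain ⟨⟨c, s⟩, hxF⟩ := Set.mem_iUnion.1 (hFc.symm ▸ Set.mem_univ (f x) : f x ∈ ⋃ p, F p)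
  exact hgF ⟨c, by omega⟩ c.is_lt s x hxF (hx _)

theorem card_le_topDim {ι : Type*} [Fintype ι] {Q : Type*} [MetricSpace Q] [CompactSpace Q]
    (f : C(ι → unitInterval, Q)) (hf : ∀ x y i, f x = f y → x i = 0 → y i ≠ 1) :
    (Fintype.card ι : ℕ∞) ≤ topDim Q := by
  induction h : topDim Q using ENat.recTopCoe with
  | top => exact le_top
  | coe k =>
    let e := Fintype.equivFin ι
    refine Nat.cast_le.2 (card_le_topDim_of_fin (f.comp ⟨fun x i => x (e i), by fun_prop⟩)
      (fun x y i hxy hx => ?_) h.le)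
    have := hf (fun j => x (e j)) (fun j => y (e j)) (e.symm i) hxy
    simpa using this (by simpa using hx)

/-! ### The Ornstein–Weiss lemma -/

section OrnsteinWeiss

variable {G : Type*} [Group G]

theorem finite_boundary (F K : Finset G) : (boundary F K).Finite := by
  classical
  refine (Finset.finite_toSet (K.biUnion fun k => F.image fun f => k⁻¹ * f)).subset ?_
  rintro g ⟨⟨k, hk, hg⟩, -⟩
  simp only [Finset.coe_biUnion, Finset.coe_image, Set.mem_iUnion, Set.mem_image]
  exact ⟨k, hk, k * g, hg, by simp⟩

theorem boundary_mono {F K L : Finset G} (h : K ⊆ L) : boundary F K ⊆ boundary F L := by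
  rintro g ⟨⟨k, hk, hg⟩, k', hk', hg'⟩
  exact ⟨⟨k, h hk, hg⟩, k', h hk', hg'⟩

theorem boundary_union_subset [DecidableEq G] (A B K : Finset G) :
    boundary (A ∪ B) K ⊆ boundary A K ∪ boundary B K := by
  rintro g ⟨⟨k, hk, hg⟩, k', hk', hg'⟩
  rw [Finset.mem_union, not_or] at hg'
  rcases Finset.mem_union.1 hg with h | h
  · exact Or.inl ⟨⟨k, hk, h⟩, k', hk', hg'.1⟩
  · exact Or.inr ⟨⟨k, hk, h⟩, k', hk', hg'.2⟩

theorem boundary_sdiff_subset [DecidableEq G] (F A K : Finset G) :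
    boundary (F \ A) K ⊆ boundary F K ∪ boundary A K := by
  rintro g ⟨⟨k, hk, hg⟩, k', hk', hg'⟩
  rw [Finset.mem_sdiff] at hg hg'
  by_cases h : k' * g ∈ F
  · exact Or.inr ⟨⟨k', hk', by tauto⟩, k, hk, hg.2⟩
  · exact Or.inl ⟨⟨k, hk, hg.1⟩, k', hk', h⟩

theorem ncard_boundary_image_mul_right_le [DecidableEq G] (T K : Finset G) (c : G) :
    (boundary (T.image (· * c)) K).ncard ≤ (boundary T K).ncard := by
  have hmem : ∀ x, x ∈ T.image (· * c) ↔ x * c⁻¹ ∈ T := fun x => by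
    simp
  refine Set.ncard_le_ncard_of_injOn (· * c⁻¹) ?_ (fun _ _ _ _ h => mul_right_cancel h)
    (finite_boundary _ _)
  rintro g ⟨⟨k, hk, hg⟩, k', hk', hg'⟩
  rw [hmem, mul_assoc] at hg hg'
  exact ⟨⟨k, hk, hg⟩, k', hk', hg'⟩

theorem ncard_boundary_biUnion_le [DecidableEq G] (T K C : Finset G) :
    (boundary (C.biUnion fun c => T.image (· * c)) K).ncard ≤ C.card * (boundary T K).ncard := by
  induction C using Finset.induction_on with
  | empty => simp [boundary]
  | insert c C hc ih =>
    rw [Finset.biUnion_insert, Finset.card_insert_of_notMem hc, add_mul, one_mul, add_comm]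
    refine (Set.ncard_le_ncard (boundary_union_subset _ _ _)
      ((finite_boundary _ _).union (finite_boundary _ _))).trans ((Set.ncard_union_le _ _).trans ?_)
    exact add_le_add (ncard_boundary_image_mul_right_le T K c) ih

theorem apply_biUnion_translate_le [DecidableEq G] {h : Finset G → ℝ} (h0 : h ∅ ≤ 0)
    (hsub : ∀ A B, h (A ∪ B) ≤ h A + h B) (hinv : ∀ F g, h (F.image (· * g)) ≤ h F)
    (T C : Finset G) : h (C.biUnion fun c => T.image (· * c)) ≤ C.card * h T := by
  induction C using Finset.induction_on with
  | empty => simpa using h0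
  | insert c C hc ih =>
    rw [Finset.biUnion_insert, Finset.card_insert_of_notMem hc]
    push_cast
    have := hsub (T.image (· * c)) (C.biUnion fun c => T.image (· * c))
    have := hinv T c
    linarith

/-- Almost disjoint translates of `T` fill a definite proportion of a set that is almost invariant
under `T`. -/
theorem exists_translates_filling [DecidableEq G] {T : Finset G} (hT : T.Nonempty) (F : Finset G)
    {ε : ℝ} (hε0 : 0 < ε) (hε1 : ε < 1) : ∃ C : Finset G,
      (C.biUnion fun c => T.image (· * c)) ⊆ F ∧
      (1 - ε) * (T.card * C.card) ≤ (C.biUnion fun c => T.image (· * c)).card ∧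
      ε * (F.card - (boundary F T).ncard) ≤ (C.biUnion fun c => T.image (· * c)).card := by
  obtain ⟨t₀, ht₀⟩ := hT
  have hTpos : (0 : ℝ) < T.card := by exact_mod_cast Finset.card_pos.2 ⟨t₀, ht₀⟩
  let I := F.image (t₀⁻¹ * ·)
  -- `I` has as many elements as `F`, and a candidate in `I` whose translate leaves `F` lies in the
  -- `T`-boundary.
  let D := I.filter fun c => ∀ t ∈ T, t * c ∈ F
  let U : Finset G → Finset G := fun C => C.biUnion fun c => T.image (· * c)
  let P := D.powerset.filter fun C => (1 - ε) * (T.card * C.card) ≤ (U C).card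
  have hP : P.Nonempty := ⟨∅, by simp [P, U]⟩
  obtain ⟨C, hCP, hCmax⟩ := P.exists_max_image Finset.card hP
  obtain ⟨hCD, hC⟩ := Finset.mem_filter.1 hCP
  rw [Finset.mem_powerset] at hCD
  refine ⟨C, ?_, hC, ?_⟩
  · refine Finset.biUnion_subset.2 fun c hc => Finset.image_subset_iff.2 fun t ht => ?_
    exact (Finset.mem_filter.1 (hCD hc)).2 t ht
  · have hcard : ∀ c, (T.image (· * c)).card = T.card := fun c =>
      Finset.card_image_of_injective _ (mul_left_injective c)
    -- By maximality of `C`, a translate meeting `U C` in fewer than ε|T| points could have been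
    -- added.
    have hlarge : ∀ c ∈ D, ε * T.card ≤ (T.image (· * c) ∩ U C).card := by
      intro c hc
      by_cases hcC : c ∈ C
      · rw [Finset.inter_eq_left.2 (Finset.subset_biUnion_of_mem (fun c => T.image (· * c)) hcC),
          hcard]
        nlinarith
      · have hnot : insert c C ∉ P := fun h => by
          have := hCmax _ h
          rw [Finset.card_insert_of_notMem hcC] at this
          omega
        have hlt : ((U (insert c C)).card : ℝ) < (1 - ε) * (T.card * (C.card + 1)) := by
          by_contra! hle
          refine hnot (Finset.mem_filter.2 ⟨Finset.mem_powerset.2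
            (Finset.insert_subset hc hCD), ?_⟩)
          rw [Finset.card_insert_of_notMem hcC]
          exact_mod_cast hle
        have hui : (U (insert c C)).card + (T.image (· * c) ∩ U C).card = T.card + (U C).card := by
          rw [show U (insert c C) = T.image (· * c) ∪ U C from Finset.biUnion_insert,
            Finset.card_union_add_card_inter, hcard]
        have hui' : ((U (insert c C)).card : ℝ) + (T.image (· * c) ∩ U C).card =
          T.card + (U C).card := by exact_mod_cast hui
        nlinarith
    -- Double counting of the pairs (t, c) with tc in `U C`.
    have hcount : ∑ c ∈ D, (T.image (· * c) ∩ U C).card ≤ T.card * (U C).card := by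
      have h1 : ∀ c ∈ D, (T.image (· * c) ∩ U C).card ≤
          ∑ t ∈ T, if t * c ∈ U C then 1 else 0 := by
        intro c _
        rw [← Finset.card_filter]
        refine (Finset.card_le_card (t := (T.filter fun t => t * c ∈ U C).image (· * c)) ?_).trans
          Finset.card_image_le
        intro x hx
        obtain ⟨hx1, hx2⟩ := Finset.mem_inter.1 hx
        obtain ⟨t, ht, rfl⟩ := Finset.mem_image.1 hx1
        exact Finset.mem_image_of_mem _ (Finset.mem_filter.2 ⟨ht, hx2⟩)
      refine (Finset.sum_le_sum h1).trans ?_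
      rw [Finset.sum_comm]
      refine (Finset.sum_le_card_nsmul _ _ (U C).card fun t _ => ?_).trans (by simp)
      rw [← Finset.card_filter]
      refine Finset.card_le_card_of_injOn (t * ·) (fun c hc => ?_)
        (fun _ _ _ _ h => mul_left_cancel h)
      exact (Finset.mem_filter.1 hc).2
    have hDA : ε * D.card ≤ (U C).card := by
      have h2 : (D.card : ℝ) * (ε * T.card) ≤ T.card * (U C).card := by
        refine le_trans ?_ (show ((∑ c ∈ D, (T.image (· * c) ∩ U C).card : ℕ) : ℝ) ≤ _ by
          exact_mod_cast hcount)
        push_cast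
        rw [← nsmul_eq_mul]
        exact Finset.card_nsmul_le_sum _ _ _ hlarge
      refine le_of_mul_le_mul_left ?_ hTpos
      linarith
    have hFD : F.card ≤ D.card + (boundary F T).ncard := by
      have hI : I.card = F.card := Finset.card_image_of_injective _ (mul_right_injective _)
      rw [← hI, ← Set.ncard_coe_finset, ← Set.ncard_coe_finset D]
      refine (Set.ncard_le_ncard ?_ (D.finite_toSet.union (finite_boundary F T))).trans
        (Set.ncard_union_le _ _)
      intro c hc
      by_cases hcD : c ∈ D
      · exact Or.inl hcD
      · refine Or.inr ?_
        have : ¬ ∀ t ∈ T, t * c ∈ F := fun h => hcD (Finset.mem_filter.2 ⟨hc, h⟩)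
        push Not at this
        obtain ⟨f, hf, rfl⟩ := Finset.mem_image.1 hc
        exact ⟨⟨t₀, ht₀, by simpa using hf⟩, this⟩
    have hFD' : (F.card : ℝ) ≤ D.card + (boundary F T).ncard := by exact_mod_cast hFD
    nlinarith

/-- Translates of a good `T` fill at least the proportion ε/2 of `F`, and there the bound `b` holds,
the factor 1 − ε paying for overlaps. The rest is still invariant enough for the bound `a`, unless
it has at most η|F| elements and costs at most Mη|F|. -/
theorem exists_improved_bound [DecidableEq G] {h : Finset G → ℝ} {M : ℝ}
    (hM : ∀ F, h F ≤ M * F.card) (hM0 : 0 ≤ M)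
    (hsub : ∀ A B, h (A ∪ B) ≤ h A + h B) (hinv : ∀ F g, h (F.image (· * g)) ≤ h F)
    {K : Finset G} {a b δ ε η : ℝ} (hδ : 0 < δ) (hb : 0 ≤ b) (hba : b ≤ a)
    (hε0 : 0 < ε) (hε1 : ε < 1) (hη : 0 < η)
    (ha : ∀ F : Finset G, F.Nonempty → (boundary F K).ncard ≤ δ * F.card → h F ≤ a * F.card)
    (hT : ∀ δ' : ℝ, 0 < δ' → ∃ T : Finset G, T.Nonempty ∧ (boundary T K).ncard ≤ δ' * T.card ∧
      h T ≤ (1 - ε) * b * T.card) :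
    ∃ (L : Finset G) (δ' : ℝ), L.Nonempty ∧ 0 < δ' ∧ ∀ F : Finset G, F.Nonempty →
      (boundary F L).ncard ≤ δ' * F.card → h F ≤ (a - (a - b) * ε / 2 + M * η) * F.card := by
  have hε : 0 < 1 - ε := by linarith
  -- The boundary of the rest may be δη|F|. Half is spent on the translates, where (1 − ε)|T||C| ≤
  -- |F|, and half on `F` itself.
  obtain ⟨T, hTne, hTK, hTh⟩ := hT (δ * η * (1 - ε) / 2) (by positivity)
  refine ⟨T ∪ K, min (1 / 2) (δ * η / 2), hTne.mono Finset.subset_union_left,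
    by positivity, fun F hF hFL => ?_⟩
  obtain ⟨C, hAF, hA1, hA2⟩ := exists_translates_filling hTne F hε0 hε1
  set A := C.biUnion fun c => T.image (· * c) with hA
  have hFpos : (0 : ℝ) < F.card := by exact_mod_cast hF.card_pos
  have hBT : ((boundary F T).ncard : ℝ) ≤ 1 / 2 * F.card := by
    have : ((boundary F T).ncard : ℝ) ≤ (boundary F (T ∪ K)).ncard := by
      exact_mod_cast Set.ncard_le_ncard (boundary_mono Finset.subset_union_left)
        (finite_boundary _ _)
    refine this.trans (hFL.trans ?_)
    gcongr
    exact min_le_left _ _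
  have hBK : ((boundary F K).ncard : ℝ) ≤ δ * η / 2 * F.card := by
    have : ((boundary F K).ncard : ℝ) ≤ (boundary F (T ∪ K)).ncard := by
      exact_mod_cast Set.ncard_le_ncard (boundary_mono Finset.subset_union_right)
        (finite_boundary _ _)
    refine this.trans (hFL.trans ?_)
    gcongr
    exact min_le_right _ _
  have hAcard : ε * (F.card / 2) ≤ A.card := by
    refine le_trans ?_ hA2
    gcongr
    linarith
  have hRcard : ((F \ A).card : ℝ) = F.card - A.card := by
    rw [Finset.card_sdiff_of_subset hAF, Nat.cast_sub (Finset.card_le_card hAF)]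
  have hAleF : (A.card : ℝ) ≤ F.card := by exact_mod_cast Finset.card_le_card hAF
  have hhA : h A ≤ b * A.card := by
    have h1 := apply_biUnion_translate_le (by simpa using hM ∅) hsub hinv T C
    have h2 := mul_le_mul_of_nonneg_left hTh (Nat.cast_nonneg (α := ℝ) C.card)
    have h3 := mul_le_mul_of_nonneg_left hA1 hb
    linarith
  have hhR : h (F \ A) ≤ a * (F \ A).card + M * η * F.card := by
    by_cases hsmall : ((F \ A).card : ℝ) ≤ η * F.card
    · have h1 := hM (F \ A)
      have h2 := mul_le_mul_of_nonneg_left hsmall hM0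
      have h3 : 0 ≤ a * (F \ A).card := mul_nonneg (hb.trans hba) (Nat.cast_nonneg _)
      linarith
    · rw [not_le] at hsmall
      have hRne : (F \ A).Nonempty := by
        rw [← Finset.card_pos]
        have : (0 : ℝ) < (F \ A).card := lt_trans (by positivity) hsmall
        exact_mod_cast this
      have hB : ((boundary (F \ A) K).ncard : ℝ) ≤ δ * (F \ A).card := by
        have h1 : ((boundary (F \ A) K).ncard : ℝ) ≤
            (boundary F K).ncard + C.card * (boundary T K).ncard := by
          have := ((Set.ncard_le_ncard (boundary_sdiff_subset F A K)
            ((finite_boundary _ _).union (finite_boundary _ _))).trans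
            (Set.ncard_union_le _ _)).trans
            (add_le_add le_rfl (ncard_boundary_biUnion_le T K C))
          exact_mod_cast this
        have h2 := mul_le_mul_of_nonneg_left hTK (Nat.cast_nonneg (α := ℝ) C.card)
        have h3 := mul_le_mul_of_nonneg_left (hA1.trans hAleF) (show 0 ≤ δ * η / 2 by positivity)
        have h4 := mul_le_mul_of_nonneg_left hsmall.le hδ.le
        linarith
      have h1 := ha _ hRne hB
      have h3 : 0 ≤ M * η * F.card := by positivity
      linarith
  have hF' : h F ≤ h A + h (F \ A) := by
    have := hsub A (F \ A)
    rwa [Finset.union_sdiff_of_subset hAF] at this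
  rw [hRcard] at hhR
  have h5 := mul_le_mul_of_nonneg_left hAcard (sub_nonneg.2 hba)
  linarith

/-- The Ornstein–Weiss lemma. -/
theorem exists_tendsto_of_subadditive [DecidableEq G] (hG : IsAmenable G) {h : Finset G → ℝ} {M : ℝ}
    (h0 : ∀ F, 0 ≤ h F) (hM : ∀ F, h F ≤ M * F.card)
    (hsub : ∀ A B, h (A ∪ B) ≤ h A + h B) (hinv : ∀ F g, h (F.image (· * g)) ≤ h F) :
    ∃ a : ℝ, 0 ≤ a ∧ ∀ F : ℕ → Finset G, IsFolnerSeq F →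
      Tendsto (fun n => h (F n) / (F n).card) atTop (𝓝 a) := by
  obtain ⟨E, hE⟩ := hG
  have hM0 : 0 ≤ M := by
    have := (h0 {1}).trans (hM {1})
    simpa using this
  have hinvt : ∀ F : ℕ → Finset G, IsFolnerSeq F → ∀ K : Finset G, K.Nonempty → ∀ δ : ℝ, 0 < δ →
      ∀ᶠ n in atTop, ((boundary (F n) K).ncard : ℝ) ≤ δ * (F n).card := by
    intro F hF K hK δ hδ
    filter_upwards [(hF.tendsto K hK).eventually (gt_mem_nhds hδ)] with n hn
    have : (0 : ℝ) < (F n).card := by exact_mod_cast (hF.nonempty n).card_pos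
    exact ((div_lt_iff₀ this).1 hn).le
  -- The bounds valid for all sufficiently invariant sets; their infimum is the limit.
  let Λ : Set ℝ := {a | ∃ (K : Finset G) (δ : ℝ), K.Nonempty ∧ 0 < δ ∧ ∀ F : Finset G, F.Nonempty →
    (boundary F K).ncard ≤ δ * F.card → h F ≤ a * F.card}
  have hΛ0 : ∀ a ∈ Λ, 0 ≤ a := by
    rintro a ⟨K, δ, hK, hδ, ha⟩
    obtain ⟨n, hn⟩ := (hinvt E hE K hK δ hδ).exists
    have : (0 : ℝ) < (E n).card := by exact_mod_cast (hE.nonempty n).card_pos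
    exact nonneg_of_mul_nonneg_left ((h0 _).trans (ha _ (hE.nonempty n) hn)) this
  have hΛne : Λ.Nonempty := ⟨M, {1}, 1, by simp, one_pos, fun F _ _ => hM F⟩
  have hbdd : BddBelow Λ := ⟨0, hΛ0⟩
  refine ⟨sInf Λ, le_csInf hΛne hΛ0, fun F hF => ?_⟩
  have hFpos : ∀ n, (0 : ℝ) < (F n).card := fun n => by exact_mod_cast (hF.nonempty n).card_pos
  rw [tendsto_order]
  constructor
  · intro x hx
    by_contra hnot
    rw [not_eventually] at hnot
    set s := sInf Λ with hs
    set y := max x 0 with hy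
    have hys : y ≤ s := max_le hx.le (le_csInf hΛne hΛ0)
    rcases (le_csInf hΛne hΛ0).eq_or_lt with hs0 | hspos
    · rw [← hs0] at hs
      obtain ⟨n, hn⟩ := hnot.exists
      exact hn (lt_of_lt_of_le (by rw [hs0]; exact hx) (div_nonneg (h0 _) (hFpos n).le))
    have hys : y < s := max_lt hx hspos
    have hy0 : 0 ≤ y := le_max_right _ _
    -- `b` lies strictly between `y` and `s`, and `y = (1 - ε) b`
    set b := (y + s) / 2 with hb
    have hyb : y < b := by linarith
    have hbs : b < s := by linarith
    have hb0 : 0 < b := by linarith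
    set ε := (b - y) / b with hεd
    have hε0 : 0 < ε := div_pos (by linarith) hb0
    have hyb' : (1 - ε) * b = y := by rw [hεd]; field_simp; ring
    -- If `y = 0` then `ε = 1`, whereas the filling needs a parameter below 1.
    obtain ⟨ε', hε'0, hε'1, hε'ε⟩ : ∃ ε' : ℝ, 0 < ε' ∧ ε' < 1 ∧ ε' ≤ ε :=
      ⟨min ε (1 / 2), by positivity, (min_le_right _ _).trans_lt (by norm_num), min_le_left _ _⟩
    have hgap : 0 < (s - b) * ε' / 2 := by have := sub_pos.2 hbs; positivity
    -- The excess of `a` over the infimum and the error `M * η` each use up less than half of the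
    -- gain, so the improved bound falls below the infimum.
    obtain ⟨a, ⟨K, δ, hK, hδ, ha⟩, has⟩ := exists_lt_of_csInf_lt hΛne
      (show sInf Λ < s + (s - b) * ε' / 2 / 2 by linarith)
    have hsa : s ≤ a := csInf_le hbdd ⟨K, δ, hK, hδ, ha⟩
    set η := (s - b) * ε' / 2 / 2 / (M + 1) with hη
    have hη0 : 0 < η := by positivity
    have hMη : M * η < (s - b) * ε' / 2 / 2 := by
      rw [hη, mul_div_assoc', div_lt_iff₀ (by linarith)]
      nlinarith
    obtain ⟨L, δ', hL, hδ', hbound⟩ := exists_improved_bound hM hM0 hsub hinv (K := K)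
      (a := a) (b := b) hδ hb0.le (hbs.le.trans hsa) hε'0 hε'1 hη0 ha (fun δ' hδ' => by
        obtain ⟨n, hn, hn'⟩ := (hnot.and_eventually (hinvt F hF K hK δ' hδ')).exists
        refine ⟨F n, hF.nonempty n, hn', ?_⟩
        rw [not_lt, div_le_iff₀ (hFpos n)] at hn
        refine hn.trans (mul_le_mul_of_nonneg_right ?_ (hFpos n).le)
        have h1 : x ≤ y := le_max_left _ _
        have h2 : (1 - ε) * b ≤ (1 - ε') * b := by gcongr
        linarith)
    have hmem : a - (a - b) * ε' / 2 + M * η ∈ Λ := ⟨L, δ', hL, hδ', hbound⟩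
    have h1 := csInf_le hbdd hmem
    have h2 : (s - b) * ε' / 2 ≤ (a - b) * ε' / 2 := by gcongr
    linarith
  · intro x hx
    obtain ⟨a, ⟨K, δ, hK, hδ, ha⟩, hax⟩ := exists_lt_of_csInf_lt hΛne hx
    filter_upwards [hinvt F hF K hK δ hδ] with n hn
    exact ((div_le_iff₀ (hFpos n)).2 (ha _ (hF.nonempty n) hn)).trans_lt hax

end OrnsteinWeiss

/-! ### The dimension of a polyhedron -/

section Simplex

variable {E : Type*} [NormedAddCommGroup E] [NormedSpace ℝ E] {k : ℕ}

/-- Barycentric coordinates: a continuous bijection from a compact space to a Hausdorff space. -/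
theorem exists_simplex_homeomorph {p : Fin (k + 1) → E} (hp : AffineIndependent ℝ p) :
    Nonempty (stdSimplex ℝ (Fin (k + 1)) ≃ₜ convexHull ℝ (Set.range p)) := by
  let f : stdSimplex ℝ (Fin (k + 1)) → E := fun w => ∑ i, w.1 i • p i
  have hfc : Continuous f := continuous_finsetSum _ fun i _ =>
    ((continuous_apply i).comp continuous_subtype_val).smul continuous_const
  have hfi : Function.Injective f := by
    intro v w hvw
    refine Subtype.ext ((affineIndependent_iff_eq_of_fintype_affineCombination_eq ℝ p).1 hp _ _
      v.2.2 w.2.2 ?_)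
    rw [Finset.affineCombination_eq_linear_combination _ _ _ v.2.2,
      Finset.affineCombination_eq_linear_combination _ _ _ w.2.2]
    exact hvw
  have hrange : Set.range f = convexHull ℝ (Set.range p) := by
    rw [convexHull_range_eq_exists_affineCombination]
    ext x
    constructor
    · rintro ⟨w, rfl⟩
      exact ⟨Finset.univ, w.1, fun i _ => w.2.1 i, w.2.2,
        Finset.affineCombination_eq_linear_combination _ _ _ w.2.2⟩
    · rintro ⟨s, w, hw0, hw1, rfl⟩
      have hsum : ∑ i, (s : Set (Fin (k + 1))).indicator w i = 1 := by
        rw [← hw1, Finset.sum_indicator_subset _ (Finset.subset_univ s)]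
      have hmem : (s : Set (Fin (k + 1))).indicator w ∈ stdSimplex ℝ (Fin (k + 1)) :=
        ⟨fun i => Set.indicator_nonneg hw0 i, hsum⟩
      refine ⟨⟨_, hmem⟩, ?_⟩
      rw [ Finset.affineCombination_indicator_subset w p (Finset.subset_univ s),
        Finset.affineCombination_eq_linear_combination _ _ _ hsum]
  have : CompactSpace (stdSimplex ℝ (Fin (k + 1))) :=
    isCompact_iff_compactSpace.1 (isCompact_stdSimplex ℝ (Fin (k + 1)))
  exact ⟨((hfc.isClosedEmbedding hfi).isEmbedding.toHomeomorph).trans (Homeomorph.setCongr hrange)⟩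

theorem topDim_stdSimplex_le (k : ℕ) : topDim (stdSimplex ℝ (Fin (k + 1))) ≤ k := by
  have : CompactSpace (stdSimplex ℝ (Fin (k + 1))) :=
    isCompact_iff_compactSpace.1 (isCompact_stdSimplex ℝ (Fin (k + 1)))
  let f : stdSimplex ℝ (Fin (k + 1)) → Fin k → unitInterval := fun w i =>
    ⟨w.1 i.succ, mem_Icc_of_mem_stdSimplex w.2 _⟩
  have hfc : Continuous f := continuous_pi fun i => by
    exact ((continuous_apply i.succ).comp continuous_subtype_val).subtype_mk _
  have hfi : Function.Injective f := by
    intro v w hvw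
    have h : ∀ i : Fin k, v.1 i.succ = w.1 i.succ := fun i => congrArg Subtype.val (congrFun hvw i)
    refine Subtype.ext (funext (Fin.cases ?_ h))
    have hv := v.2.2
    have hw := w.2.2
    rw [Fin.sum_univ_succ, Finset.sum_congr rfl fun i _ => h i] at hv
    rw [Fin.sum_univ_succ] at hw
    linarith
  have := topDim_le_of_isClosedEmbedding (hfc.isClosedEmbedding hfi)
    (topDim_pi_fin_le topDim_unitInterval_le k)
  simpa using this

theorem exists_cube_embedding_stdSimplex (k : ℕ) :
    ∃ f : C(Fin k → unitInterval, stdSimplex ℝ (Fin (k + 1))), Function.Injective f := by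
  let g : (Fin k → unitInterval) → Fin (k + 1) → ℝ := fun u =>
    Fin.cons (1 - ∑ i, (u i : ℝ) / (k + 1)) fun i => (u i : ℝ) / (k + 1)
  have hk : (0 : ℝ) < k + 1 := by positivity
  have hg : ∀ u, g u ∈ stdSimplex ℝ (Fin (k + 1)) := by
    intro u
    refine ⟨fun i => Fin.cases (motive := fun i => 0 ≤ g u i) ?_ (fun i => ?_) i, ?_⟩
    · simp only [g, Fin.cons_zero]
      rw [← Finset.sum_div, sub_nonneg, div_le_one hk]
      refine (Finset.sum_le_card_nsmul _ _ 1 fun i _ => (u i).2.2).trans ?_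
      simp
    · simp only [g, Fin.cons_succ]
      exact div_nonneg (u i).2.1 hk.le
    · rw [Fin.sum_univ_succ]
      simp [g]
  have hgc : Continuous g := continuous_pi (Fin.cases
    (by simp only [g, Fin.cons_zero]; fun_prop) fun i => by simp only [g, Fin.cons_succ]; fun_prop)
  refine ⟨⟨fun u => ⟨g u, hg u⟩, hgc.subtype_mk hg⟩, fun u v huv => funext fun i => ?_⟩
  have h := congrFun (congrArg Subtype.val huv) i.succ
  simp only [ContinuousMap.coe_mk, g, Fin.cons_succ] at h
  exact Subtype.ext ((div_left_inj' hk.ne').1 h)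

end Simplex

theorem MeanDimension.IsPolyhedron.compactSpace {P : Type*} [TopologicalSpace P] (hP : IsPolyhedron P) :
    CompactSpace P := by
  obtain ⟨N, K, hK, ⟨e⟩⟩ := hP
  have : IsCompact K.space :=
    hK.isCompact_biUnion fun s _ => s.finite_toSet.isCompact_convexHull ℝ
  have := isCompact_iff_compactSpace.1 this
  exact e.symm.compactSpace

theorem exists_range_eq_of_mem_faces {N : ℕ}
    {K : Geometry.SimplicialComplex ℝ (EuclideanSpace ℝ (Fin N))}
    {s : Finset (EuclideanSpace ℝ (Fin N))} (hs : s ∈ K.faces) {k : ℕ} (hk : s.card = k + 1) :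
    ∃ p : Fin (k + 1) → EuclideanSpace ℝ (Fin N), AffineIndependent ℝ p ∧ Set.range p = s := by
  let e : s ≃ Fin (k + 1) := s.equivFinOfCardEq hk
  refine ⟨fun i => e.symm i, (K.indep hs).comp_embedding e.symm.toEmbedding, ?_⟩
  ext x
  constructor
  · rintro ⟨i, rfl⟩
    exact (e.symm i).2
  · intro hx
    exact ⟨e ⟨x, hx⟩, by simp⟩

/-- A nonempty polyhedron contains a cube whose dimension bounds the dimension of the polyhedron. -/
theorem MeanDimension.IsPolyhedron.exists_cube {P : Type*} [TopologicalSpace P] [Nonempty P]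
    (hP : IsPolyhedron P) : ∃ (m : ℕ) (Q : Type) (_ : MetricSpace Q) (_ : CompactSpace Q)
      (_ : P ≃ₜ Q) (j : C(Fin m → unitInterval, P)), Function.Injective j ∧ topDim Q ≤ m := by
  classical
  have hPc := hP.compactSpace
  obtain ⟨N, K, hK, ⟨e⟩⟩ := hP
  have hcomp : CompactSpace K.space := e.compactSpace
  have hne : hK.toFinset.Nonempty := by
    obtain ⟨x⟩ := ‹Nonempty P›
    obtain ⟨s, hs, -⟩ := Geometry.SimplicialComplex.mem_space_iff.1 (e x).2
    exact ⟨s, by simpa using hs⟩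
  obtain ⟨s, hs, hmax⟩ := hK.toFinset.exists_max_image Finset.card hne
  simp only [Set.Finite.mem_toFinset] at hs hmax
  obtain ⟨m, hm⟩ := Nat.exists_eq_succ_of_ne_zero
    (Geometry.SimplicialComplex.nonempty_of_mem_faces hs).card_pos.ne'
  obtain ⟨p, hp, hps⟩ := exists_range_eq_of_mem_faces hs hm
  obtain ⟨φ⟩ := exists_simplex_homeomorph hp
  obtain ⟨c, hc⟩ := exists_cube_embedding_stdSimplex m
  have hsub : convexHull ℝ (Set.range p) ⊆ K.space := by
    rw [hps]; exact Geometry.SimplicialComplex.convexHull_subset_space hs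
  -- The complex itself serves as `Q`: it lives in `Type`, like the targets allowed in `epsDim`.
  refine ⟨m, K.space, inferInstance, inferInstance, e,
    ⟨fun u => e.symm (Set.inclusion hsub (φ (c u))), ?_⟩, ?_, ?_⟩
  · exact e.symm.continuous.comp ((continuous_inclusion hsub).comp
      (φ.continuous.comp c.continuous))
  · exact e.symm.injective.comp ((Set.inclusion_injective hsub).comp (φ.injective.comp hc))
  · refine topDim_le_of_closed_cover
      (hK.toFinset.image fun t : Finset (EuclideanSpace ℝ (Fin N)) =>
        ((↑) : K.space → EuclideanSpace ℝ (Fin N)) ⁻¹' convexHull ℝ (t : Set _)) ?_ ?_ ?_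
    · intro A hA
      obtain ⟨t, -, rfl⟩ := Finset.mem_image.1 hA
      exact (t.finite_toSet.isCompact_convexHull ℝ).isClosed.preimage continuous_subtype_val
    · intro x
      obtain ⟨t, ht, hx⟩ := Geometry.SimplicialComplex.mem_space_iff.1 x.2
      exact ⟨_, Finset.mem_image_of_mem _ (by simpa using ht), hx⟩
    · intro A hA
      obtain ⟨t, ht, rfl⟩ := Finset.mem_image.1 hA
      rw [Set.Finite.mem_toFinset] at ht
      obtain ⟨k, hk⟩ := Nat.exists_eq_succ_of_ne_zero
        (Geometry.SimplicialComplex.nonempty_of_mem_faces ht).card_pos.ne'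
      obtain ⟨q, hq, hqt⟩ := exists_range_eq_of_mem_faces ht hk
      obtain ⟨ψ⟩ := exists_simplex_homeomorph hq
      rw [hqt] at ψ
      have hkm : k ≤ m := by have := hmax t ht; omega
      have hdim : topDim (convexHull ℝ (t : Set (EuclideanSpace ℝ (Fin N)))) ≤ k :=
        ψ.symm.topDim_le (topDim_stdSimplex_le k)
      refine (Homeomorph.topDim_le ?_ hdim).trans (by exact_mod_cast hkm)
      exact
        { toFun := fun x => ⟨x.1.1, x.2⟩
          invFun := fun x =>
            ⟨⟨x.1, Geometry.SimplicialComplex.convexHull_subset_space ht x.2⟩, x.2⟩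
          left_inv := fun _ => rfl
          right_inv := fun _ => rfl
          continuous_toFun := by fun_prop
          continuous_invFun := by fun_prop }

/-! ### Widths -/

theorem IsCompact.exists_pos_forall_lt {Y : Type*} [TopologicalSpace Y] {Z : Set Y}
    (hZ : IsCompact Z) {q : Y → ℝ} (hq : Continuous q) (hpos : ∀ z ∈ Z, 0 < q z) :
    ∃ ε : ℝ, 0 < ε ∧ ∀ z ∈ Z, ε < q z := by
  rcases Z.eq_empty_or_nonempty with rfl | hne
  · exact ⟨1, one_pos, by simp⟩
  · obtain ⟨z₀, hz₀, hmin⟩ := hZ.exists_isMinOn hne hq.continuousOn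
    exact ⟨q z₀ / 2, half_pos (hpos z₀ hz₀), fun z hz =>
      (half_lt_self (hpos z₀ hz₀)).trans_le (hmin hz)⟩

theorem dynDist_le_iff {G X : Type*} [Group G] [MulAction G X] {d : X → X → ℝ} {F : Finset G}
    {ε : ℝ} (hε : 0 ≤ ε) {x y : X} :
    dynDist d F x y ≤ ε ↔ ∀ g ∈ F, d (g • x) (g • y) ≤ ε := by
  constructor
  · intro h g hg
    exact (le_ciSup (f := fun g : F => d ((g : G) • x) ((g : G) • y)) (Set.finite_range _).bddAbove
      ⟨g, hg⟩).trans h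
  · exact fun h => Real.iSup_le (fun g => h g g.2) hε

theorem epsDim_le {X : Type*} [TopologicalSpace X] {d : X → X → ℝ} {ε : ℝ} {Q : Type}
    [MetricSpace Q] [CompactSpace Q] (f : C(X, Q)) (hf : IsEpsInjective d ε f) :
    epsDim X d ε ≤ topDim Q :=
  iInf_le_of_le Q <| iInf_le_of_le _ <| iInf_le_of_le ‹_› <| iInf_le _ ⟨f, hf⟩

theorem exists_of_epsDim_le {X : Type*} [TopologicalSpace X] {d : X → X → ℝ} {ε : ℝ} {n : ℕ}
    (h : epsDim X d ε ≤ n) : ∃ (Q : Type) (_ : MetricSpace Q) (_ : CompactSpace Q) (f : C(X, Q)),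
      IsEpsInjective d ε f ∧ topDim Q ≤ n := by
  have hlt : epsDim X d ε < n + 1 := h.trans_lt (by exact_mod_cast Nat.lt_succ_self n)
  simp only [epsDim, iInf_lt_iff] at hlt
  obtain ⟨Q, hQm, hQc, ⟨f, hf⟩, hQ⟩ := hlt
  exact ⟨Q, hQm, hQc, f, hf, Order.lt_add_one_iff_of_not_isMax (by simp) |>.1 hQ⟩

section DynDist

variable {G X : Type*} [Group G] [TopologicalSpace X] [MulAction G X] {d : X → X → ℝ} {ε : ℝ}

/-- The pair of two ε-injective maps controls both parts, and its target is a product. -/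
theorem epsDim_dynDist_union_le [DecidableEq G] (hε : 0 ≤ ε) {A B : Finset G} {m n : ℕ}
    (hA : epsDim X (dynDist d A) ε ≤ m) (hB : epsDim X (dynDist d B) ε ≤ n) :
    epsDim X (dynDist d (A ∪ B)) ε ≤ (m + n : ℕ) := by
  obtain ⟨Q, _, _, f, hf, hQ⟩ := exists_of_epsDim_le hA
  obtain ⟨R, _, _, g, hg, hR⟩ := exists_of_epsDim_le hB
  refine (epsDim_le (f.prodMk g) fun x y hxy => ?_).trans (topDim_prod_le hQ hR)
  have hxy := Prod.mk.inj hxy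
  refine (dynDist_le_iff hε).2 fun h hh => ?_
  rcases Finset.mem_union.1 hh with hh | hh
  · exact (dynDist_le_iff hε).1 (hf x y hxy.1) h hh
  · exact (dynDist_le_iff hε).1 (hg x y hxy.2) h hh

/-- The distance for Fg at x, y is the distance for F at gx, gy, so one precomposes with g. -/
theorem epsDim_dynDist_image_mul_right_le [DecidableEq G] (hε : 0 ≤ ε) {g : G}
    (hg : Continuous fun x : X => g • x) (F : Finset G) :
    epsDim X (dynDist d (F.image (· * g))) ε ≤ epsDim X (dynDist d F) ε := by
  refine le_iInf fun Q => le_iInf fun _ => le_iInf fun _ => le_iInf fun ⟨f, hf⟩ => ?_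
  refine epsDim_le (f.comp ⟨_, hg⟩) fun x y hxy => (dynDist_le_iff hε).2 fun h hh => ?_
  obtain ⟨k, hk, rfl⟩ := Finset.mem_image.1 hh
  rw [mul_smul, mul_smul]
  exact (dynDist_le_iff hε).1 (hf _ _ hxy) k hk

theorem exists_tendsto_epsDim_div (hG : IsAmenable G) (hc : ∀ g : G, Continuous fun x : X => g • x)
    (hε : 0 ≤ ε) {M : ℕ} (hM : ∀ F : Finset G, epsDim X (dynDist d F) ε ≤ (M * F.card : ℕ)) :
    ∃ a : ℝ≥0∞, ∀ F : ℕ → Finset G, IsFolnerSeq F →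
      Tendsto (fun n => (epsDim X (dynDist d (F n)) ε : ℝ≥0∞) / ((F n).card : ℝ≥0∞)) atTop
        (𝓝 a) := by
  classical
  choose h hh using fun F : Finset G => ENat.ne_top_iff_exists.1
    ((hM F).trans_lt (ENat.natCast_lt_top _)).ne
  obtain ⟨a, -, ha⟩ := exists_tendsto_of_subadditive hG (h := fun F => (h F : ℝ)) (M := M)
    (fun F => Nat.cast_nonneg _)
    (fun F => by
      have := hM F
      rw [← hh] at this
      exact_mod_cast this)
    (fun A B => by
      have := epsDim_dynDist_union_le hε (hh A).ge (hh B).ge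
      rw [← hh] at this
      exact_mod_cast this)
    (fun F g => by
      have := epsDim_dynDist_image_mul_right_le (d := d) hε (hc g) F
      rw [← hh, ← hh] at this
      exact_mod_cast this)
  refine ⟨ENNReal.ofReal a, fun F hF => ?_⟩
  convert! (ENNReal.continuous_ofReal.tendsto a).comp (ha F hF) using 2 with n
  have : (0 : ℝ) < (F n).card := by exact_mod_cast (hF.nonempty n).card_pos
  rw [Function.comp_apply, ENNReal.ofReal_div_of_pos this, ENNReal.ofReal_natCast,
    ENNReal.ofReal_natCast, ← hh, ENat.toENNReal_coe]

end DynDist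

/-! ### Subshifts -/

section Subshift

variable {G P : Type*} [Group G] [TopologicalSpace P] (X : Subshift G P)

theorem continuous_subshift_apply (k : G) : Continuous fun x : X.carrier => x.1 k :=
  (continuous_apply k).comp continuous_subtype_val

theorem continuous_subshift_smul (g : G) : Continuous fun x : X.carrier => g • x :=
  continuous_induced_rng.2 (continuous_pi fun h => continuous_subshift_apply X (h * g))

theorem subshift_smul_apply (g h : G) (x : X.carrier) : (g • x).1 h = x.1 (h * g) := rfl

theorem Subshift.compactSpace [CompactSpace P] : CompactSpace X.carrier :=
  isCompact_iff_compactSpace.1 X.isClosed.isCompact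

/-- Pairs at distance at least ε form a compact set, and none of them agree in all coordinates;
finitely many coordinates already suffice. -/
theorem exists_finset_dist_lt [CompactSpace P] [T2Space P] {d : X.carrier → X.carrier → ℝ}
    (hdc : Continuous fun p : X.carrier × X.carrier => d p.1 p.2) (hd : ∀ x, d x x = 0) {ε : ℝ}
    (hε : 0 < ε) : ∃ K : Finset G, ∀ x y : X.carrier, (∀ k ∈ K, x.1 k = y.1 k) → d x y < ε := by
  have := Subshift.compactSpace X
  obtain ⟨K, hK⟩ := (isClosed_le continuous_const hdc :
      IsClosed {p : X.carrier × X.carrier | ε ≤ d p.1 p.2}).isCompact.elim_finite_subfamily_closed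
    (fun k : G => {p : X.carrier × X.carrier | p.1.1 k = p.2.1 k})
    (fun k => isClosed_eq ((continuous_subshift_apply X k).comp continuous_fst)
      ((continuous_subshift_apply X k).comp continuous_snd)) (by
      rw [Set.eq_empty_iff_forall_notMem]
      rintro ⟨x, y⟩ ⟨h1, h2⟩
      obtain rfl : x = y := Subtype.ext (funext fun k => Set.mem_iInter.1 h2 k)
      have h1 : ε ≤ d x x := h1
      rw [hd] at h1
      linarith)
  refine ⟨K, fun x y hxy => ?_⟩
  by_contra! hle
  exact (Set.eq_empty_iff_forall_notMem.1 hK (x, y)) ⟨hle, Set.mem_iInter₂.2 hxy⟩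

theorem epsDim_subshift_le [DecidableEq G] {Q : Type} [MetricSpace Q] [CompactSpace Q] (e : P ≃ₜ Q)
    {m : ℕ} (hQ : topDim Q ≤ m) {d : X.carrier → X.carrier → ℝ} {ε : ℝ} (hε : 0 ≤ ε) {K : Finset G}
    (hK : ∀ x y : X.carrier, (∀ k ∈ K, x.1 k = y.1 k) → d x y < ε) (F : Finset G) :
    epsDim X.carrier (dynDist d F) ε ≤ ((Finset.image₂ (· * ·) K F).card * m : ℕ) := by
  let s := (Finset.image₂ (· * ·) K F).equivFin
  refine (epsDim_le (Q := Fin (Finset.image₂ (· * ·) K F).card → Q)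
    ⟨fun x i => e (x.1 (s.symm i)), continuous_pi fun i =>
      e.continuous.comp (continuous_subshift_apply X _)⟩ fun x y hxy => ?_).trans (topDim_pi_fin_le hQ _)
  refine (dynDist_le_iff hε).2 fun g hg => (hK _ _ fun k hk => ?_).le
  have := congrFun hxy (s ⟨k * g, Finset.mem_image₂_of_mem hk hg⟩)
  simpa [subshift_smul_apply] using this

theorem card_mul_le_add_boundary [DecidableEq G] (K F : Finset G) :
    (Finset.image₂ (· * ·) (insert 1 K) F).card ≤
      F.card + (insert 1 K).card * (boundary F (insert 1 K)).ncard := by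
  set L := insert 1 K
  have hsub : Finset.image₂ (· * ·) L F ⊆
      F ∪ Finset.image₂ (· * ·) L (finite_boundary F L).toFinset := by
    intro x hx
    obtain ⟨k, hk, g, hg, rfl⟩ := Finset.mem_image₂.1 hx
    by_cases h : k * g ∈ F
    · exact Finset.mem_union_left _ h
    -- Since 1 was inserted into `K`, a point g of `F` with kg outside `F` lies in the boundary.
    · refine Finset.mem_union_right _ (Finset.mem_image₂_of_mem hk ?_)
      rw [Set.Finite.mem_toFinset]
      exact ⟨⟨1, Finset.mem_insert_self _ _, by simpa using hg⟩, k, hk, h⟩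
  refine (Finset.card_le_card hsub).trans ((Finset.card_union_le _ _).trans ?_)
  rw [Set.ncard_eq_toFinset_card _ (finite_boundary F L)]
  gcongr
  exact Finset.card_image₂_le _ _ _

end Subshift

/-! ### Lower bound for the widths -/

theorem exists_le_epsDim_subshift {G P : Type*} [Group G] [MetricSpace P] [CompactSpace P]
    (X : Subshift G P) {d : X.carrier → X.carrier → ℝ}
    (hdc : Continuous fun p : X.carrier × X.carrier => d p.1 p.2)
    (hd : ∀ x y, x ≠ y → 0 < d x y) {m : ℕ} (j : C(Fin m → unitInterval, P))
    (hj : Function.Injective j) (J : Set G) {c : ℝ} (hc : 0 < c) (W : G → Set P)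
    (hWX : Set.univ.pi W ⊆ X.carrier) (hW : (Set.univ.pi W).Nonempty)
    (hf : ∀ g ∈ J, ∃ f : C(P, W g), ∀ x y : P, dist x y ≤ c * dist (f x) (f y)) :
    ∃ ε₀ : ℝ, 0 < ε₀ ∧ ∀ ε : ℝ, 0 ≤ ε → ε ≤ ε₀ → ∀ F : Finset G,
      (m * (J ∩ F).ncard : ℕ) ≤ epsDim X.carrier (dynDist d F) ε := by
  classical
  have := Subshift.compactSpace X
  obtain ⟨w, hw⟩ := hW
  have hWne : ∀ g, Nonempty C(P, W g) := fun g => ⟨ContinuousMap.const P ⟨w g, hw g trivial⟩⟩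
  choose! f hf using hf
  -- η is a lower bound for the distance in P between images of points on opposite faces of the
  -- cube.
  obtain ⟨η, hη, hjη⟩ := (isClosed_iUnion_of_finite fun i : Fin m =>
    (isClosed_eq (by fun_prop) continuous_const : IsClosed
      {p : (Fin m → unitInterval) × (Fin m → unitInterval) | p.1 i = 0}).inter
    (isClosed_eq (by fun_prop) continuous_const : IsClosed
      {p : (Fin m → unitInterval) × (Fin m → unitInterval) | p.2 i = 1})).isCompact.exists_pos_forall_lt
    (q := fun p => dist (j p.1) (j p.2)) (by fun_prop) (by
      intro p hp
      obtain ⟨i, hi0, hi1⟩ := Set.mem_iUnion.1 hp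
      refine dist_pos.2 fun h => zero_ne_one (α := unitInterval) ?_
      rw [← show p.1 i = 0 from hi0, ← show p.2 i = 1 from hi1, hj h])
  -- Points within ε₀ have coordinates at 1 closer than η/c. Because (gx)₁ = x_g, the dynamical
  -- distance transfers this to every coordinate in `F`, with ε₀ independent of `F`.
  obtain ⟨ε₀, hε₀, hdε⟩ := (isClosed_le continuous_const
    (((continuous_subshift_apply X 1).comp continuous_fst).dist
      ((continuous_subshift_apply X 1).comp continuous_snd)) : IsClosed
      {p : X.carrier × X.carrier | η / c ≤ dist (p.1.1 1) (p.2.1 1)}).isCompact.exists_pos_forall_lt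
    hdc (by
      rintro ⟨x, y⟩ hxy
      refine hd x y fun h => ?_
      have hxy : η / c ≤ dist (x.1 1) (y.1 1) := hxy
      rw [h, dist_self] at hxy
      exact absurd hxy (not_le.2 (by positivity)))
  refine ⟨ε₀, hε₀, fun ε hε hεε₀ F => ?_⟩
  let S := F.filter (· ∈ J)
  have hcard : m * (J ∩ F).ncard = Fintype.card (Fin m × S) := by
    rw [show J ∩ F = (S : Set G) by ext; simp [S, and_comm], Set.ncard_coe_finset]
    simp
  let Φ : (Fin m × S → unitInterval) → G → P := fun u g =>
    if hg : g ∈ S then f g (j fun i => u (i, ⟨g, hg⟩)) else w g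
  have hΦ : ∀ u, Φ u ∈ X.carrier := fun u => hWX fun g _ => by
    simp only [Φ]
    split_ifs with hg
    · exact (f g _).2
    · exact hw g trivial
  have hΦc : Continuous Φ := continuous_pi fun g => by
    by_cases hg : g ∈ S
    · simp only [Φ, dif_pos hg]
      fun_prop
    · simp only [Φ, dif_neg hg]
      fun_prop
  refine le_iInf fun Q => le_iInf fun _ => le_iInf fun _ => le_iInf fun ⟨q, hq⟩ => ?_
  rw [hcard]
  refine card_le_topDim (q.comp ⟨fun u => ⟨Φ u, hΦ u⟩, hΦc.subtype_mk hΦ⟩) ?_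
  rintro u v ⟨i, g, hg⟩ huv hu hv
  have hgF : g ∈ F := (Finset.mem_filter.1 hg).1
  have hgJ : g ∈ J := (Finset.mem_filter.1 hg).2
  have h1 := (dynDist_le_iff hε).1 (hq _ _ huv) g hgF
  have h2 : dist (Φ u g) (Φ v g) < η / c := by
    by_contra! hle
    have := hdε (g • ⟨Φ u, hΦ u⟩, g • ⟨Φ v, hΦ v⟩) (by
      simpa only [Set.mem_ofPred_eq, subshift_smul_apply, one_mul] using hle)
    exact absurd (h1.trans hεε₀) (not_le.2 this)
  have h3 := hf g hgJ (j fun i => u (i, ⟨g, hg⟩)) (j fun i => v (i, ⟨g, hg⟩))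
  have h4 := hjη (fun i => u (i, ⟨g, hg⟩), fun i => v (i, ⟨g, hg⟩))
    (Set.mem_iUnion.2 ⟨i, hu, hv⟩)
  simp only [Φ, dif_pos hg] at h2
  rw [← Subtype.dist_eq, lt_div_iff₀ hc] at h2
  have h4 : η < dist (j fun i => u (i, ⟨g, hg⟩)) (j fun i => v (i, ⟨g, hg⟩)) := h4
  linarith

/-! ### Computation of the mean dimension -/

theorem continuous_dist_of_eq {X : Type*} [t : TopologicalSpace X] (d : MetricSpace X)
    (hd : d.toUniformSpace.toTopologicalSpace = t) :
    Continuous fun p : X × X => d.dist p.1 p.2 := by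
  subst hd
  exact continuous_dist

theorem upperDensity_univ {G : Type*} [Group G] (hG : IsAmenable G) :
    upperDensity (Set.univ : Set G) = 1 := by
  obtain ⟨E, hE⟩ := hG
  have key : ∀ F : ℕ → Finset G, IsFolnerSeq F →
      limsup (fun n => (((Set.univ : Set G) ∩ (F n : Set G)).ncard : ℝ≥0∞) /
        ((F n).card : ℝ≥0∞)) atTop = 1 := by
    intro F hF
    have : (fun n => (((Set.univ : Set G) ∩ (F n : Set G)).ncard : ℝ≥0∞) /
        ((F n).card : ℝ≥0∞)) = fun _ => 1 := by
      ext n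
      rw [Set.univ_inter, Set.ncard_coe_finset, ENNReal.div_self]
      · exact_mod_cast (hF.nonempty n).card_pos.ne'
      · exact ENNReal.natCast_ne_top _
    rw [this, limsup_const]
  exact le_antisymm (iSup₂_le fun F hF => (key F hF).le) ((key E hE).symm.le.trans
    (le_iSup₂ (f := fun (F : ℕ → Finset G) (_ : IsFolnerSeq F) =>
      limsup (fun n => (((Set.univ : Set G) ∩ (F n : Set G)).ncard : ℝ≥0∞) /
        ((F n).card : ℝ≥0∞)) atTop) E hE))

theorem hasMeanDim_subshift {G P : Type*} [Group G] (hG : IsAmenable G)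
    [MetricSpace P] (hP : IsPolyhedron P) (X : Subshift G P) (J : ℕ → Set G)
    (c : ℕ → ℝ) (hc : ∀ n, 0 < c n)
    (hJ : Tendsto (fun n => upperDensity (J n)) atTop (𝓝 1)) (W : ℕ → G → Set P)
    (hWX : ∀ n, Set.univ.pi (W n) ⊆ X.carrier) (hW : ∀ n, (Set.univ.pi (W n)).Nonempty)
    (hf : ∀ n, ∀ g ∈ J n, ∃ f : C(P, W n g), ∀ x y : P, dist x y ≤ c n * dist (f x) (f y)) :
    HasMeanDim G X.carrier (topDim P) := by
  classical
  have hPc := hP.compactSpace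
  have : Nonempty P := ⟨(hW 0).choose 1⟩
  obtain ⟨m, Q, _, _, e, j, hj, hQ⟩ := hP.exists_cube
  have hdim : topDim P = m := by
    refine le_antisymm (e.topDim_le hQ) ?_
    have := card_le_topDim j fun x y i hxy hx hy => zero_ne_one (α := unitInterval) (by
      rw [← hx, ← hy, hj hxy])
    simpa using this
  rw [hdim, ENat.toENNReal_coe]
  intro d hd
  have hdc : Continuous fun p : X.carrier × X.carrier => d.dist p.1 p.2 :=
    continuous_dist_of_eq d hd
  have hd0 : ∀ x, d.dist x x = 0 := d.dist_self
  have hdpos : ∀ x y, x ≠ y → 0 < d.dist x y := fun x y hxy => @dist_pos _ d _ _ |>.2 hxy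
  have hupper : ∀ ε : ℝ, 0 < ε → ∃ K : Finset G, ∀ F,
      epsDim X.carrier (dynDist d.dist F) ε ≤
        ((Finset.image₂ (· * ·) (insert 1 K) F).card * m : ℕ) := fun ε hε => by
    obtain ⟨K, hK⟩ := exists_finset_dist_lt X hdc hd0 hε
    exact ⟨K, epsDim_subshift_le X e hQ hε.le
      fun x y hxy => hK x y fun k hk => hxy k (Finset.mem_insert_of_mem hk)⟩
  have hlim : ∀ ε : ℝ, 0 < ε → ∃ a : ℝ≥0∞, ∀ F : ℕ → Finset G, IsFolnerSeq F →
      Tendsto (fun n => (epsDim X.carrier (dynDist d.dist (F n)) ε : ℝ≥0∞) /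
        ((F n).card : ℝ≥0∞)) atTop (𝓝 a) := fun ε hε => by
    obtain ⟨K, hK⟩ := hupper ε hε
    refine exists_tendsto_epsDim_div hG (continuous_subshift_smul X) hε.le
      (M := (insert 1 K).card * m) fun F => (hK F).trans ?_
    have := Nat.mul_le_mul_right m (Finset.card_image₂_le (· * ·) (insert 1 K) F)
    rw [mul_right_comm]
    exact_mod_cast this
  choose! a ha using hlim
  refine ⟨a, ha, ?_⟩
  obtain ⟨E, hE⟩ := hG
  rw [tendsto_order]
  constructor
  · intro b hb
    have hmJ : Tendsto (fun n => (m : ℝ≥0∞) * upperDensity (J n)) atTop (𝓝 m) := by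
      have := ENNReal.Tendsto.const_mul (a := (m : ℝ≥0∞)) hJ (Or.inr (ENNReal.natCast_ne_top m))
      rwa [mul_one] at this
    obtain ⟨n, hn⟩ := (hmJ.eventually (lt_mem_nhds hb)).exists
    simp only [upperDensity, ENNReal.mul_iSup, lt_iSup_iff] at hn
    -- A Følner sequence nearly attaining the upper density; the limit `a ε` may be computed along
    -- it.
    obtain ⟨F, hF, hn⟩ := hn
    rw [← ENNReal.limsup_const_mul_of_ne_top (ENNReal.natCast_ne_top m)] at hn
    obtain ⟨ε₀, hε₀, hlow⟩ := exists_le_epsDim_subshift X hdc hdpos j hj (J n) (hc n) (W n)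
      (hWX n) (hW n) (hf n)
    filter_upwards [Ioc_mem_nhdsGT hε₀] with ε hε
    refine hn.trans_le ?_
    rw [← (ha ε hε.1 F hF).limsup_eq]
    refine limsup_le_limsup (Eventually.of_forall fun k => ?_)
    simp only
    rw [← mul_div_assoc]
    refine ENNReal.div_le_div_right ?_ _
    have := ENat.toENNReal_le.2 (hlow ε hε.1.le hε.2 (F k))
    rw [ENat.toENNReal_coe] at this
    exact_mod_cast this
  · intro b hb
    filter_upwards [self_mem_nhdsWithin] with ε hε
    refine lt_of_le_of_lt ?_ hb
    obtain ⟨K, hK⟩ := hupper ε hε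
    -- The right-hand side bounds m|KF|/|F| and tends to m because the boundary is negligible.
    have hB : Tendsto (fun n => ENNReal.ofReal ((1 + (insert 1 K).card *
        (((boundary (E n) (insert 1 K)).ncard : ℝ) / (E n).card)) * m)) atTop (𝓝 m) := by
      have h1 := (((hE.tendsto (insert 1 K) (Finset.insert_nonempty _ _)).const_mul
        ((insert 1 K).card : ℝ)).const_add 1).mul_const (m : ℝ)
      have h2 := (ENNReal.continuous_ofReal.tendsto _).comp h1
      simpa [Function.comp_def] using h2
    refine le_of_tendsto_of_tendsto' (ha ε hε E hE) hB fun n => ?_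
    have hpos : (0 : ℝ) < (E n).card := by exact_mod_cast (hE.nonempty n).card_pos
    have h1 := ENat.toENNReal_le.2 (hK (E n))
    rw [ENat.toENNReal_coe] at h1
    refine (ENNReal.div_le_div_right h1 _).trans ?_
    rw [← ENNReal.ofReal_natCast, ← ENNReal.ofReal_natCast (E n).card,
      ← ENNReal.ofReal_div_of_pos hpos]
    refine ENNReal.ofReal_le_ofReal ?_
    have h2 : ((Finset.image₂ (· * ·) (insert 1 K) (E n)).card : ℝ) ≤
        (E n).card + (insert 1 K).card * (boundary (E n) (insert 1 K)).ncard := by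
      exact_mod_cast card_mul_le_add_boundary K (E n)
    rw [div_le_iff₀ hpos]
    have h3 : (1 + ((insert 1 K).card : ℝ) * (((boundary (E n) (insert 1 K)).ncard : ℝ) /
        (E n).card)) * m * (E n).card =
        ((E n).card + (insert 1 K).card * (boundary (E n) (insert 1 K)).ncard) * m := by
      field_simp
    rw [h3]
    push_cast
    gcongr

theorem corollary2p11 {G P : Type*} [Group G] [Countable G] (hG : IsAmenable G)
    [MetricSpace P] (hP : IsPolyhedron P) (X : Subshift G P)
    (J : ℕ → Set G) (hJmono : Monotone J)
    (c : ℕ → ℝ) (hc : ∀ n, 0 < c n)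
    (x₀ : G → P) (hx₀ : x₀ ∈ X.carrier)
    (hJ : Tendsto (fun n => upperDensity (J n)) atTop (𝓝 1))
    (W : ℕ → G → Set P)
    (hWX : ∀ n, Set.univ.pi (W n) ⊆ X.carrier)
    (hWx₀ : ∀ n, (J n)ᶜ.domRestrict x₀ ∈ (J n)ᶜ.domRestrict '' Set.univ.pi (W n))
    (hf : ∀ n, ∀ g ∈ J n, ∃ f : C(P, W n g), ∀ x y : P, dist x y ≤ c n * dist (f x) (f y)) :
    HasMeanDim G X.carrier (topDim P) ∧ HasMeanDim G (fullShift G P).carrier (topDim P) := by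
  refine ⟨hasMeanDim_subshift hG hP X J c hc hJ W hWX (fun n => ?_) hf,
    -- For the full shift every coordinate is free, with identity maps and constant 1.
    hasMeanDim_subshift hG hP (fullShift G P) (fun _ => Set.univ) (fun _ => 1) (fun _ => one_pos)
      ?_ (fun _ _ => Set.univ) (fun _ => Set.subset_univ _) (fun _ => ⟨x₀, fun _ _ => trivial⟩)
      fun _ _ _ => ⟨⟨fun x => ⟨x, trivial⟩, by fun_prop⟩, fun x y => (one_mul _).ge⟩⟩
  · obtain ⟨w, hw, -⟩ := hWx₀ n
    exact ⟨w, hw⟩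
  · simp only [upperDensity_univ hG]
    exact tendsto_const_nhds
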